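/- **Setting.** Let $N\ge 1$ and $M,n\ge 0$ be integers, $\alpha_i>0$, $\gamma_i\ge 0$ ($i=1,\dots,N$) and $\beta_k>0$ ($k=1,\dots,M$). For each $i$ let $f_i:\mathbb R^n\to\mathbb R$ be differentiable and $m_i$-strongly convex with $m_i>0$, and let $\nabla f_i$ be $l_i$-Lipschitz. Let $R_N,R_K\in\mathbb R^{N\times M}$ satisfy $\ker(R_N^\top)=\ker(R_K^\top)=\{a\mathbf 1_N : a\in\mathbb R\}$. Agent $i$ is the system with state $x_i$, input $u_i$ and output $y_i$ in $\mathbb R^n$, $$\dot x_i=-\alpha_i\nabla f_i(x_i+\gamma_iu_i)+\alpha_iu_i,\qquad y_i=x_i+\gamma_iu_i .$$ Controller $k$ is the integrator $\dot z_k=\beta_k\zeta_k$ with output $d_k=z_k\in\mathbb R^n$. The interconnection is $$u=-(R_K\otimes I_n)\,d,\qquad \zeta=(R_N\otimes I_n)^\top y ,$$ so the closed loop, with state $(x,z)\in\mathbb R^{Nn}\times\mathbb R^{Mn}$, is $$\dot x=-\alpha\nabla f(x+\gamma u)+\alpha u,\qquad \dot z=\beta(R_N\otimes I_n)^\top y,\qquad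 y=x+\gamma u,\quad u=-(R_K\otimes I_n)z,$$ where $\alpha,\beta,\gamma$ act as the block diagonal matrices $\operatorname{diag}(\alpha_i)\otimes I_n$, $\operatorname{diag}(\beta_k)\otimes I_n$, $\operatorname{diag}(\gamma_i)\otimes I_n$, and $\nabla f(y)$ is the stacked vector of the $\nabla f_i(y_i)$. Agent $i$ is called *input and output strictly equilibrium-independent passive with indices $(\nu_i,\rho_i)$* if for every equilibrium $(\bar x_i,\bar u_i)$ of agent $i$, with output $\bar y_i$, and for all $x_i,u_i$, the storage function $S_i=\frac1{2\alpha_i}\|x_i-\bar x_i\|^2$ satisfies $$\nabla_{x_i} S_i^\top\dot x_i\le \tilde y_i^\top\tilde u_i-\nu_i\tilde u_i^\top\tilde u_i-\rho_i\tilde y_i^\top\tilde y_i,\qquad \tilde u_i=u_i-\bar u_i,\ \tilde y_i=y_i-\bar y_i .$$ **Theorem.** Each agent $i$ is input and output strictly equilibrium-independent passive with indices $\nu_i=\frac12\gamma_i$ and $\rho_i=m_i-\frac12\gamma_il_i^2$. Moreover, let $(\nu_i,\rho_i)$, with $\rho_i>0$, be any indices with which the agents $i=1,\dots,N$ are input and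 output strictly equilibrium-independent passive, and put $K=\operatorname{diag}(\rho_i)$ and $L=R_K^\top\operatorname{diag}(\nu_i)R_K$. Assume that the matrix $$\begin{pmatrix}2K & R_K-R_N\\ (R_K-R_N)^\top & 2L\end{pmatrix}$$ is positive semidefinite and that every complex eigenvalue of $\operatorname{diag}(\beta_k)\,R_N^\top K^{-1}(R_K-R_N)$ is zero or has positive real part. Then $\sum_i f_i$ has a unique minimizer $y^*\in\mathbb R^n$; every equilibrium $(\bar x,\bar z)$ of the closed loop has outputs $\bar y_i=y^*$ for all $i$; and this optimal consensus equilibrium is globally asymptotically stable in the following sense: from every initial state there is a solution on $[0,\infty)$; every equilibrium is Lyapunov stable (with $\delta(\varepsilon)$ independent of the equilibrium); every solution on $[0,\infty)$ converges, as $t\to\infty$, to an equilibrium $(\bar x,\bar z)$; and $y_i(t)\to y^*$ for all $i$ along every solution. -/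

import Mathlib

open scoped Matrix Topology

noncomputable section

namespace DistOpt

/-- The space `ℝⁿ` with its Euclidean inner product. -/
abbrev Vec (n : ℕ) : Type := EuclideanSpace ℝ (Fin n)

/-! ### Input-output systems and equilibrium-independent passivity -/

/-- The system `x' = χ(x, u)`, `y = ψ(x, u)` is equilibrium-independent dissipative with storage
function `S(x, xbar)` and supply rate `w(u, y)`: relative to every equilibrium `(xbar, ubar)` of the
system the storage function is continuously differentiable, nonnegative, zero at the equilibrium,
and its derivative along the system is at most the supply rate in the error variables. -/
structure IsEquilibriumIndependentDissipative {n : ℕ} (χ ψ : Vec n → Vec n → Vec n)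
    (S : Vec n → Vec n → ℝ) (w : Vec n → Vec n → ℝ) : Prop where
  contDiff : ∀ xbar ubar, χ xbar ubar = 0 → ContDiff ℝ 1 (fun x => S x xbar)
  eq_zero : ∀ xbar ubar, χ xbar ubar = 0 → S xbar xbar = 0
  nonneg : ∀ x xbar ubar, χ xbar ubar = 0 → 0 ≤ S x xbar
  dissipation : ∀ x u xbar ubar, χ xbar ubar = 0 →
    inner ℝ (gradient (fun x' => S x' xbar) x) (χ x u) ≤
      w (u - ubar) (ψ x u - ψ xbar ubar)

/-- The supply rate `w(u, y) = yᵀu - ν uᵀu - ρ yᵀy`. -/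
def passivitySupply {n : ℕ} (ν ρ : ℝ) (u y : Vec n) : ℝ :=
  inner ℝ y u - ν * inner ℝ u u - ρ * inner ℝ y y

/-! ### Agents with feedthrough -/

/-- Right-hand side of the agent dynamics `x' = -a ∇f(x + g u) + a u`. -/
def agentDynamics {n : ℕ} (a g : ℝ) (f : Vec n → ℝ) (x u : Vec n) : Vec n :=
  -(a • gradient f (x + g • u)) + a • u

/-- Output of the agent, `y = x + g u`. -/
def agentOutput {n : ℕ} (g : ℝ) (x u : Vec n) : Vec n :=
  x + g • u

/-- The agent with gain `a`, feedthrough `g` and objective `f` is simultaneously input strictly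
(index `ν`) and output strictly (index `ρ`) equilibrium-independent passive, with the storage
function `‖x - xbar‖² / (2 a)`. -/
def AgentIsISOSEIP {n : ℕ} (a g : ℝ) (f : Vec n → ℝ) (ν ρ : ℝ) : Prop :=
  IsEquilibriumIndependentDissipative (agentDynamics a g f) (agentOutput g)
    (fun x xbar => 1 / (2 * a) * inner ℝ (x - xbar) (x - xbar)) (passivitySupply ν ρ)

/-! ### The closed loop -/

/-- The kernel of `Rᵀ` is the line spanned by the all-ones vector. -/
def HasNullspaceProperty {ι κ : Type*} [Fintype ι] (R : Matrix ι κ ℝ) : Prop :=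
  LinearMap.ker (Rᵀ).mulVecLin = Submodule.span ℝ {(1 : ι → ℝ)}

/-- State `(x, z)` of the closed loop: `x i` is the state of agent `i`, `z k` that of controller
`k`. -/
abbrev State (ι κ : Type*) (n : ℕ) : Type _ := (ι → Vec n) × (κ → Vec n)

/-- The agent inputs `u = -(R_K ⊗ I_n) z` (the controller outputs are `d = z`). -/
def agentInput {ι κ : Type*} [Fintype κ] {n : ℕ} (RK : Matrix ι κ ℝ)
    (p : State ι κ n) (i : ι) : Vec n :=
  -∑ k, RK i k • p.2 k

/-- The agent outputs `y = x + γ u` in the closed loop. -/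
def closedLoopOutput {ι κ : Type*} [Fintype κ] {n : ℕ} (γ : ι → ℝ) (RK : Matrix ι κ ℝ)
    (p : State ι κ n) (i : ι) : Vec n :=
  agentOutput (γ i) (p.1 i) (agentInput RK p i)

/-- The vector field of the closed loop: the agents with the above inputs, and the integrator
controllers `z' = β ζ` with inputs `ζ = (R_N ⊗ I_n)ᵀ y`. -/
def closedLoop {ι κ : Type*} [Fintype ι] [Fintype κ] {n : ℕ} (α : ι → ℝ) (β : κ → ℝ)
    (γ : ι → ℝ) (f : ι → Vec n → ℝ) (RN RK : Matrix ι κ ℝ) (p : State ι κ n) : State ι κ n :=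
  (fun i => agentDynamics (α i) (γ i) (f i) (p.1 i) (agentInput RK p i),
   fun k => β k • ∑ i, RN i k • closedLoopOutput γ RK p i)

/-! ### Solutions, equilibria and stability -/

/-- `φ` is a solution of `p' = F(p)` on `[0, ∞)`. -/
def IsSolution {X : Type*} [NormedAddCommGroup X] [NormedSpace ℝ X] (F : X → X) (φ : ℝ → X) :
    Prop :=
  ∀ t, 0 ≤ t → HasDerivWithinAt φ (F (φ t)) (Set.Ici 0) t

/-- The equilibria of `p' = F(p)`. -/
def equilibria {X : Type*} [Zero X] (F : X → X) : Set X :=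
  {p | F p = 0}

/-- Global asymptotic stability of a set `M` of equilibria of `p' = F(p)`: solutions exist for all
initial states and all nonnegative times, the points of `M` are Lyapunov stable (uniformly over
`M`), and every solution converges to a point of `M`. For a one-point set this is global asymptotic
stability of an equilibrium point in the usual sense. -/
structure IsGloballyAsymptoticallyStable {X : Type*} [NormedAddCommGroup X] [NormedSpace ℝ X]
    (F : X → X) (M : Set X) : Prop where
  exists_solution : ∀ p₀, ∃ φ, IsSolution F φ ∧ φ 0 = p₀
  stable : ∀ ε > 0, ∃ δ > 0, ∀ p ∈ M, ∀ φ, IsSolution F φ → dist (φ 0) p < δ →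
    ∀ t, 0 ≤ t → dist (φ t) p < ε
  attractive : ∀ φ, IsSolution F φ → ∃ p ∈ M, Filter.Tendsto φ Filter.atTop (𝓝 p)

/-! ### The matrix conditions -/

/-- `K = diag(ρ)`. -/
def matK {ι : Type*} [DecidableEq ι] (ρ : ι → ℝ) : Matrix ι ι ℝ :=
  Matrix.diagonal ρ

/-- `L = R_Kᵀ diag(ν) R_K`. -/
def matL {ι κ : Type*} [Fintype ι] [DecidableEq ι] (ν : ι → ℝ) (RK : Matrix ι κ ℝ) :
    Matrix κ κ ℝ :=
  RKᵀ * Matrix.diagonal ν * RK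

/-- The block matrix `[[2K, R_K - R_N], [(R_K - R_N)ᵀ, 2L]]`. -/
def stabilityMatrix {ι κ : Type*} [Fintype ι] [DecidableEq ι] (ν ρ : ι → ℝ)
    (RN RK : Matrix ι κ ℝ) : Matrix (ι ⊕ κ) (ι ⊕ κ) ℝ :=
  Matrix.fromBlocks ((2 : ℝ) • matK ρ) (RK - RN) (RK - RN)ᵀ ((2 : ℝ) • matL ν RK)

/-- The matrix `diag(β) R_Nᵀ K⁻¹ (R_K - R_N)`. -/
def slowMatrix {ι κ : Type*} [Fintype ι] [DecidableEq ι] [Fintype κ] [DecidableEq κ]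
    (β : κ → ℝ) (ρ : ι → ℝ) (RN RK : Matrix ι κ ℝ) : Matrix κ κ ℝ :=
  Matrix.diagonal β * RNᵀ * (matK ρ)⁻¹ * (RK - RN)

/-- Every complex eigenvalue of the real matrix `A` is zero or has positive real part. -/
def EigenvaluesZeroOrPosRe {κ : Type*} [Fintype κ] [DecidableEq κ] (A : Matrix κ κ ℝ) : Prop :=
  ∀ μ ∈ spectrum ℂ (A.map (algebraMap ℝ ℂ)), μ = 0 ∨ 0 < μ.re

end DistOpt

end

/-! The sum `V` of the storage functions of agents and controllers, centred at an equilibrium, is a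
Lyapunov function. Write `ỹ`, `z̃` for the errors of outputs and controller states. Adding the
passivity inequalities to the lossless controller terms gives `V' ≤ -½ Σ_c v_cᵀ M v_c`, where `M` is
the stability matrix and `v_c` stacks the `c`-th coordinates of `ỹ` and `z̃` (`lyapunovRate_le`).
Hence solutions stay bounded, with constants independent of the equilibrium.

`M` may be singular, so dissipation alone does not give `ỹ → 0`. Factoring `M = BᵀB`, a Barbalat
argument yields `B v_c → 0`, hence `M v_c → 0`. Its upper block says `2Kỹ + (R_K - R_N)z̃ → 0`, and
inserting this in `z̃' = β R_Nᵀ ỹ` gives `z̃' + A z̃ → 0` with `A` half of the slow matrix. The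
eigenvalue condition and boundedness force `A z̃ → 0`: stable modes decay, and a Jordan chain at
zero could persist only by growing. So `R_Nᵀ ỹ → 0`. Summing the upper block over the agents gives
`Σ ρ_i ỹ_i → 0`, and the two limits together give `ỹ → 0` (`tendsto_zero_of_slow_dynamics`).

Now `z' → 0`, the inputs vary slowly, and boundedness of `x` forces `x' → 0`. Every limit point is
therefore an equilibrium, and the Lyapunov estimate centred there makes the whole trajectory
converge.

At an equilibrium the kernel conditions give consensus of the outputs and zero sum of the inputs,
which equal the gradients; strong convexity identifies the common output with the minimizer. -/

namespace DistOpt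

/-! ### Asymptotic lemmas for curves: slow variation, Grönwall, Barbalat. -/

section ODE

open Set Filter

variable {E : Type*} [NormedAddCommGroup E] [NormedSpace ℝ E]

/-- A curve whose derivative is asymptotically `-a`, with `a` slowly varying, is bounded only if
`a` vanishes asymptotically. -/
theorem tendsto_zero_of_bounded_of_slowly_varying {v v' a a' : ℝ → E} {C : ℝ}
    (hv : ∀ t, 0 < t → HasDerivAt v (v' t) t) (ha : ∀ t, 0 < t → HasDerivAt a (a' t) t)
    (hC : ∀ t, 0 ≤ t → ‖v t‖ ≤ C)
    (hva : Tendsto (fun t => v' t + a t) atTop (𝓝 0)) (ha' : Tendsto a' atTop (𝓝 0)) :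
    Tendsto a atTop (𝓝 0) := by
  have hC0 : 0 ≤ C := (norm_nonneg _).trans (hC 0 le_rfl)
  rw [Metric.tendsto_atTop]
  intro ε hε
  -- Over a window of length `T` the curve moves by about `-T • a t`, yet by at most `2C`. Here `T`
  -- makes `Tε` exceed `2C` with room to spare, and `η` keeps both errors on the window below `ε /
  -- 4` per unit of time.
  set T : ℝ := (4 * C + 1) / ε with hT
  have hTpos : 0 < T := by positivity
  set η : ℝ := ε / (4 * (1 + T)) with hη
  have hηpos : 0 < η := by positivity
  obtain ⟨t₁, h₁⟩ := Metric.tendsto_atTop.1 hva η hηpos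
  obtain ⟨t₂, h₂⟩ := Metric.tendsto_atTop.1 ha' η hηpos
  refine ⟨max 1 (max t₁ t₂), fun t ht => ?_⟩
  have ht1 : 1 ≤ t := (le_max_left _ _).trans ht
  have htt₁ : t₁ ≤ t := (le_max_left _ _).trans ((le_max_right _ _).trans ht)
  have htt₂ : t₂ ≤ t := (le_max_right _ _).trans ((le_max_right _ _).trans ht)
  have hvar : ∀ s ∈ Icc t (t + T), ‖a s - a t‖ ≤ η * (s - t) := by
    apply norm_image_sub_le_of_norm_deriv_le_segment'
    · intro s hs
      exact (ha s (by linarith [hs.1])).hasDerivWithinAt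
    · intro s hs
      have := h₂ s (htt₂.trans hs.1)
      rw [dist_zero_right] at this
      exact this.le
  have key := norm_image_sub_le_of_norm_deriv_le_segment'
    (f := fun s => v s + (s - t) • a t) (f' := fun s => v' s + (1 : ℝ) • a t)
    (a := t) (b := t + T) (C := η + η * T)
    (fun s hs => by
      refine ((hv s (by linarith [hs.1])).add ?_).hasDerivWithinAt
      exact ((hasDerivAt_id s).sub_const t).smul_const (a t))
    (fun s hs => by
      have e : v' s + (1 : ℝ) • a t = (v' s + a s) - (a s - a t) := by rw [one_smul]; abel
      rw [e]
      refine (norm_sub_le _ _).trans (add_le_add ?_ ?_)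
      · have := h₁ s (htt₁.trans hs.1)
        rw [dist_zero_right] at this
        exact this.le
      · exact (hvar s (Ico_subset_Icc_self hs)).trans
          (mul_le_mul_of_nonneg_left (by linarith [hs.2]) hηpos.le))
    (t + T) ⟨by linarith, le_rfl⟩
  have h3 : ‖T • a t‖ ≤ (η + η * T) * T + C + C := by
    have e : T • a t = (v (t + T) + (t + T - t) • a t - (v t + (t - t) • a t))
        - v (t + T) + v t := by
      rw [sub_self, zero_smul, add_sub_cancel_left]
      abel
    rw [e]
    refine (norm_add_le _ _).trans (add_le_add ((norm_sub_le _ _).trans (add_le_add ?_ ?_)) ?_)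
    · simpa using key
    · exact hC _ (by linarith)
    · exact hC _ (by linarith)
  rw [norm_smul, Real.norm_of_nonneg hTpos.le] at h3
  rw [dist_zero_right]
  have h4 : (η + η * T) = ε / 4 := by rw [hη]; field_simp
  have h5 : T * ε = 4 * C + 1 := by rw [hT]; field_simp
  rw [h4] at h3
  by_contra hcon
  have h6 : T * ε ≤ T * ‖a t‖ := mul_le_mul_of_nonneg_left (not_lt.1 hcon) hTpos.le
  linarith

/-- A nonnegative function with `g' ≤ -c g + r`, `c > 0` and `r → 0`, tends to zero. -/
theorem tendsto_zero_of_deriv_le {g g' r : ℝ → ℝ} {c : ℝ} (hc : 0 < c)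
    (hg : ∀ t, 0 < t → HasDerivAt g (g' t) t) (hg0 : ∀ t, 0 ≤ g t)
    (hle : ∀ t, 0 < t → g' t ≤ -c * g t + r t) (hr : Tendsto r atTop (𝓝 0)) :
    Tendsto g atTop (𝓝 0) := by
  rw [Metric.tendsto_atTop]
  intro ε hε
  obtain ⟨t₁, h₁⟩ := Metric.tendsto_atTop.1 hr (c * (ε / 2)) (by positivity)
  set T := max 1 t₁
  have hT : 1 ≤ T := le_max_left _ _
  -- Beyond `T` the remainder is below `c * (ε / 2)`, so the excess of `g` over `ε / 2` decays like
  -- `exp (-c t)`.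
  have hanti : AntitoneOn (fun t => Real.exp (c * t) * (g t - ε / 2)) (Ici T) := by
    have hd : ∀ t, 0 < t → HasDerivAt (fun t => Real.exp (c * t) * (g t - ε / 2))
        (Real.exp (c * t) * (c * 1) * (g t - ε / 2) + Real.exp (c * t) * g' t) t := fun t ht =>
      (((hasDerivAt_id t).const_mul c).exp).mul ((hg t ht).sub_const _)
    refine antitoneOn_of_hasDerivWithinAt_nonpos (convex_Ici _)
      (fun t ht => (hd t (by linarith [mem_Ici.1 ht])).continuousAt.continuousWithinAt)
      (fun t ht => (hd t ?_).hasDerivWithinAt) (fun t ht => ?_)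
    · rw [interior_Ici] at ht
      linarith [mem_Ioi.1 ht]
    · rw [interior_Ici] at ht
      have ht0 : T < t := ht
      have h2 := hle t (by linarith)
      have h3 := h₁ t ((le_max_right _ _).trans ht0.le)
      rw [dist_zero_right, Real.norm_eq_abs] at h3
      have h4 := (abs_lt.1 h3).2
      have : Real.exp (c * t) * (c * 1) * (g t - ε / 2) + Real.exp (c * t) * g' t
          = Real.exp (c * t) * (c * (g t - ε / 2) + g' t) := by ring
      rw [this]
      exact mul_nonpos_of_nonneg_of_nonpos (Real.exp_pos _).le (by linarith)
  have hlim : Tendsto (fun t => Real.exp (-(c * t)) * (Real.exp (c * T) * (g T - ε / 2))) atTop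
      (𝓝 (0 * (Real.exp (c * T) * (g T - ε / 2)))) :=
    (Real.tendsto_exp_neg_atTop_nhds_zero.comp (tendsto_id.const_mul_atTop hc)).mul_const _
  rw [zero_mul] at hlim
  obtain ⟨t₂, h₂⟩ := Metric.tendsto_atTop.1 hlim (ε / 2) (by positivity)
  refine ⟨max T t₂, fun t ht => ?_⟩
  have htT : T ≤ t := (le_max_left _ _).trans ht
  have h3 := h₂ t ((le_max_right _ _).trans ht)
  rw [dist_zero_right, Real.norm_eq_abs] at h3
  have h4 := (abs_lt.1 h3).2
  have h5 := hanti (mem_Ici.2 le_rfl) (mem_Ici.2 htT) htT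
  have h6 : g t - ε / 2 ≤ Real.exp (-(c * t)) * (Real.exp (c * T) * (g T - ε / 2)) := by
    have := mul_le_mul_of_nonneg_left h5 (Real.exp_pos (-(c * t))).le
    simpa only [← mul_assoc, ← Real.exp_add, neg_add_cancel, Real.exp_zero, one_mul] using this
  rw [dist_zero_right, Real.norm_of_nonneg (hg0 t)]
  linarith

/-- A bounded-below function decreasing at least at rate `c g²`, with `g` Lipschitz, forces `g`
to vanish asymptotically. -/
theorem tendsto_zero_of_dissipation {V V' g : ℝ → ℝ} {c K : ℝ} (hc : 0 < c) (hK : 0 ≤ K)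
    (hV : ∀ t, 0 < t → HasDerivAt V (V' t) t) (hV0 : ∀ t, 0 ≤ V t)
    (hle : ∀ t, 0 < t → V' t ≤ -(c * g t ^ 2))
    (hg : ∀ s t, 0 ≤ s → s ≤ t → |g t - g s| ≤ K * (t - s)) :
    Tendsto g atTop (𝓝 0) := by
  -- The half-line starts at `1` because nothing is assumed about `V` near time `0`, not even
  -- continuity there.
  have hanti : AntitoneOn V (Ici 1) := by
    refine antitoneOn_of_hasDerivWithinAt_nonpos (f' := V') (convex_Ici _)
      (fun t ht => (hV t (by linarith [mem_Ici.1 ht])).continuousAt.continuousWithinAt)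
      (fun t ht => (hV t ?_).hasDerivWithinAt) (fun t ht => ?_) <;> rw [interior_Ici] at ht
    · linarith [mem_Ioi.1 ht]
    · have := hle t (by linarith [mem_Ioi.1 ht])
      nlinarith [sq_nonneg (g t)]
  obtain ⟨V₀, hV₀⟩ : ∃ V₀, Tendsto V atTop (𝓝 V₀) := by
    have h1 : Antitone (fun t => V (max 1 t)) := fun s t hst =>
      hanti (mem_Ici.2 (le_max_left _ _)) (mem_Ici.2 (le_max_left _ _)) (max_le_max le_rfl hst)
    have h2 := tendsto_atTop_ciInf h1 ⟨0, by rintro _ ⟨t, rfl⟩; exact hV0 _⟩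
    refine ⟨_, h2.congr' ?_⟩
    filter_upwards [eventually_ge_atTop 1] with t ht
    rw [max_eq_right ht]
  rw [Metric.tendsto_atTop]
  intro ε hε
  -- If `|g t| ≥ ε`, the Lipschitz bound keeps `|g| ≥ ε / 2` on `[t, t + τ]`. Then `V` drops by at
  -- least `c (ε / 2)² τ`, which is impossible for late `t` because `V` converges.
  set τ : ℝ := ε / (2 * (K + 1)) with hτ
  have hτpos : 0 < τ := by positivity
  have hdiff : Tendsto (fun t => V t - V (t + τ)) atTop (𝓝 (V₀ - V₀)) :=
    hV₀.sub (hV₀.comp (tendsto_atTop_add_const_right _ _ tendsto_id))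
  rw [sub_self] at hdiff
  obtain ⟨t₁, h₁⟩ := Metric.tendsto_atTop.1 hdiff (c * (ε / 2) ^ 2 * τ) (by positivity)
  refine ⟨max 1 t₁, fun t ht => ?_⟩
  have ht1 : 1 ≤ t := (le_max_left _ _).trans ht
  have h2 := h₁ t ((le_max_right _ _).trans ht)
  rw [dist_zero_right, Real.norm_eq_abs] at h2
  have h3 := (abs_lt.1 h2).2
  rw [dist_zero_right, Real.norm_eq_abs]
  by_contra hcon
  have hcon' := not_lt.1 hcon
  have hKτ : K * τ ≤ ε / 2 := by
    rw [hτ, ← mul_div_assoc, div_le_div_iff₀ (by positivity) (by norm_num)]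
    nlinarith
  have hanti2 : AntitoneOn (fun s => V s + c * (ε / 2) ^ 2 * s) (Icc t (t + τ)) := by
    refine antitoneOn_of_hasDerivWithinAt_nonpos (f' := fun s => V' s + c * (ε / 2) ^ 2 * 1)
      (convex_Icc _ _)
      (fun s hs => ((hV s (by linarith [hs.1])).add
        ((hasDerivAt_id s).const_mul _)).continuousAt.continuousWithinAt)
      (fun s hs => ((hV s ?_).add ((hasDerivAt_id s).const_mul _)).hasDerivWithinAt)
      (fun s hs => ?_) <;> rw [interior_Icc] at hs
    · linarith [hs.1]
    · have h4 := hle s (by linarith [hs.1])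
      have h5 := hg t s (by linarith) hs.1.le
      have h6 : K * (s - t) ≤ K * τ := mul_le_mul_of_nonneg_left (by linarith [hs.2]) hK
      have h7 : ε / 2 ≤ |g s| := by
        have : |g t| ≤ |g s| + |g s - g t| := by
          have := abs_sub (g s) (g s - g t)
          simpa using this
        linarith
      have h8 : (ε / 2) ^ 2 ≤ g s ^ 2 := by
        rw [← sq_abs (g s)]
        exact pow_le_pow_left₀ (by positivity) h7 2
      nlinarith
  have h9 := hanti2 ⟨le_rfl, by linarith⟩ ⟨by linarith, le_rfl⟩ (by linarith : t ≤ t + τ)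
  simp only at h9
  nlinarith

end ODE

/-! ### Bounded curves asymptotically governed by a matrix. -/

section Modes

open Set Filter Polynomial

/-- A bounded solution of `v' + μ v → 0` with `Re μ > 0` tends to zero. -/
theorem tendsto_zero_of_asymptotic_mode {v v' : ℝ → ℂ} {μ : ℂ} (hμ : 0 < μ.re)
    (hv : ∀ t, 0 < t → HasDerivAt v (v' t) t)
    (h : Tendsto (fun t => v' t + μ * v t) atTop (𝓝 0)) : Tendsto v atTop (𝓝 0) := by
  have hre : ∀ t, 0 < t → HasDerivAt (fun t => (v t).re) (v' t).re t := fun t ht =>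
    Complex.reCLM.hasFDerivAt.comp_hasDerivAt t (hv t ht)
  have him : ∀ t, 0 < t → HasDerivAt (fun t => (v t).im) (v' t).im t := fun t ht =>
    Complex.imCLM.hasFDerivAt.comp_hasDerivAt t (hv t ht)
  have key : Tendsto (fun t => (v t).re ^ 2 + (v t).im ^ 2) atTop (𝓝 0) := by
    refine tendsto_zero_of_deriv_le (c := μ.re)
      (g' := fun t => 2 * (v t).re * (v' t).re + 2 * (v t).im * (v' t).im)
      (r := fun t => ‖v' t + μ * v t‖ ^ 2 / μ.re) hμ
      (fun t ht => by
        have := ((hre t ht).fun_pow 2).fun_add ((him t ht).fun_pow 2)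
        simpa using this)
      (fun t => by positivity) (fun t ht => ?_) ?_
    · rw [← Complex.normSq_eq_norm_sq, Complex.normSq_apply]
      set p := (v' t + μ * v t).re with hp
      set q := (v' t + μ * v t).im with hq
      have h1 : (v' t).re = p - (μ.re * (v t).re - μ.im * (v t).im) := by
        simp [hp, Complex.mul_re]
      have h2 : (v' t).im = q - (μ.re * (v t).im + μ.im * (v t).re) := by
        simp [hq, Complex.mul_im]
      -- Completing the square absorbs the cross term into half of the decay `2 Re μ |v|²`, leaving
      -- rate `Re μ`.
      have h3 : (p * p + q * q) / μ.re + μ.re * ((v t).re ^ 2 + (v t).im ^ 2)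
          - 2 * (v t).re * p - 2 * (v t).im * q
          = ((p - μ.re * (v t).re) ^ 2 + (q - μ.re * (v t).im) ^ 2) / μ.re := by
        field_simp
        ring
      have h4 : 0 ≤ ((p - μ.re * (v t).re) ^ 2 + (q - μ.re * (v t).im) ^ 2) / μ.re := by
        positivity
      rw [h1, h2]
      linarith
    · have := (h.norm.pow 2).div_const μ.re
      simpa using this
  rw [tendsto_zero_iff_norm_tendsto_zero]
  have h5 := key.sqrt
  rw [Real.sqrt_zero] at h5
  refine h5.congr fun t => ?_
  rw [Complex.norm_eq_sqrt_sq_add_sq]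

variable {κ : Type*} [Fintype κ] [DecidableEq κ]

theorem continuous_mulVec {ι κ 𝕜 : Type*} [Fintype κ] [RCLike 𝕜] (B : Matrix ι κ 𝕜) : Continuous fun x : κ → 𝕜 => B *ᵥ x :=
  continuous_const.matrix_mulVec continuous_id

theorem hasDerivAt_mulVec {ι κ 𝕜 : Type*} [Fintype ι] [Fintype κ] [RCLike 𝕜]
    (B : Matrix ι κ 𝕜) {u : ℝ → κ → 𝕜} {u' : κ → 𝕜}
    {t : ℝ} (h : HasDerivAt u u' t) : HasDerivAt (fun t => B *ᵥ u t) (B *ᵥ u') t := by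
  rw [hasDerivAt_pi] at h ⊢
  intro i
  simp only [Matrix.mulVec, dotProduct]
  exact HasDerivAt.fun_sum fun j _ => (h j).const_mul _

/-- Factors of an asymptotically annihilating polynomial are peeled off one at a time, which avoids
the Jordan form. The curve is quantified inside the induction because a zero root applies the
hypothesis to `B u` in place of `u`. -/
theorem tendsto_mulVec_zero_of_prod (B : Matrix κ κ ℂ) (s : Multiset ℂ)
    (hs : ∀ μ ∈ s, μ = 0 ∨ 0 < μ.re) :
    ∀ (u u' : ℝ → κ → ℂ) (C : ℝ), (∀ t, 0 < t → HasDerivAt u (u' t) t) →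
      (∀ t, 0 ≤ t → ‖u t‖ ≤ C) → Tendsto (fun t => u' t + B *ᵥ u t) atTop (𝓝 0) →
      Tendsto (fun t => aeval B (s.map fun μ => X - Polynomial.C μ).prod *ᵥ u t) atTop (𝓝 0) →
      Tendsto (fun t => B *ᵥ u t) atTop (𝓝 0) := by
  induction s using Multiset.induction_on with
  | empty =>
    intro u u' C hu hC h hp
    simp only [Multiset.map_zero, Multiset.prod_zero, map_one, Matrix.one_mulVec] at hp
    have := ((continuous_mulVec B).tendsto 0).comp hp
    rwa [Matrix.mulVec_zero] at this
  | cons μ s ih =>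
    intro u u' C hu hC h hp
    have ih := ih fun ν hν => hs ν (Multiset.mem_cons_of_mem hν)
    set P := aeval B (s.map fun μ => X - Polynomial.C μ).prod with hP
    have hcomm : Commute P B := by
      have : Commute (aeval B (s.map fun μ => X - Polynomial.C μ).prod) (aeval B (X : ℂ[X])) :=
        (Commute.all _ _).map _
      simpa using this
    have hprod : aeval B ((μ ::ₘ s).map fun μ => X - Polynomial.C μ).prod
        = P * B - μ • P := by
      rw [Multiset.map_cons, Multiset.prod_cons, mul_comm, map_mul, ← hP, map_sub, aeval_X,
        aeval_C, mul_sub, Algebra.algebraMap_eq_smul_one, mul_smul_comm, mul_one]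
    rw [hprod] at hp
    rcases hs μ (Multiset.mem_cons_self _ _) with rfl | hμ
    · have hd : ∀ t, 0 < t → HasDerivAt (fun t => B *ᵥ u t) (B *ᵥ u' t) t := fun t ht =>
        hasDerivAt_mulVec B (hu t ht)
      have hB : Tendsto (fun t => B *ᵥ u' t + B *ᵥ (B *ᵥ u t)) atTop (𝓝 0) := by
        have := ((continuous_mulVec B).tendsto 0).comp h
        simp only [Matrix.mulVec_zero] at this
        exact this.congr fun t => Matrix.mulVec_add _ _ _
      have hBB : Tendsto (fun t => B *ᵥ (B *ᵥ u t)) atTop (𝓝 0) := by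
        refine ih (fun t => B *ᵥ u t) (fun t => B *ᵥ u' t)
          (‖(Matrix.mulVecLin B).toContinuousLinearMap‖ * C) hd (fun t ht => ?_) hB ?_
        · exact ((Matrix.mulVecLin B).toContinuousLinearMap.le_opNorm (u t)).trans
            (mul_le_mul_of_nonneg_left (hC t ht) (norm_nonneg _))
        · simpa only [zero_smul, sub_zero, Matrix.mulVec_mulVec] using hp
      -- `B (B u) → 0` gives `(B u)' → 0`, so `B u` is slowly varying, and boundedness of `u` forces
      -- it to vanish.
      refine tendsto_zero_of_bounded_of_slowly_varying hu hd hC h ?_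
      simpa only [add_sub_cancel_right, sub_zero] using hB.sub hBB
    · refine ih u u' C hu hC h ?_
      -- Since `(B - μ) P u → 0`, the curve `P u` is asymptotically a pure mode with `Re μ > 0`. It
      -- decays, and the factor `X - μ` can be dropped.
      have hPu : Tendsto (fun t => P *ᵥ u' t + B *ᵥ (P *ᵥ u t)) atTop (𝓝 0) := by
        have := ((continuous_mulVec P).tendsto 0).comp h
        simp only [Matrix.mulVec_zero] at this
        refine this.congr fun t => ?_
        simp only [Function.comp, Matrix.mulVec_add, Matrix.mulVec_mulVec, hcomm.eq]
      rw [tendsto_pi_nhds]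
      intro i
      refine tendsto_zero_of_asymptotic_mode (v' := fun t => (P *ᵥ u' t) i) hμ
        (fun t ht => hasDerivAt_pi.1 (hasDerivAt_mulVec P (hu t ht)) i) ?_
      have := tendsto_pi_nhds.1 (hPu.sub hp) i
      simp only [sub_zero, Pi.zero_apply] at this
      refine this.congr fun t => ?_
      simp only [Matrix.sub_mulVec, Matrix.smul_mulVec, Matrix.mulVec_mulVec, hcomm.eq,
        Pi.sub_apply, Pi.add_apply, Pi.smul_apply, smul_eq_mul]
      ring

/-- Needed for the factor `1/2` that the block `2K` leaves in front of the slow matrix. -/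
theorem EigenvaluesZeroOrPosRe.smul {A : Matrix κ κ ℝ} (hA : EigenvaluesZeroOrPosRe A) {c : ℝ}
    (hc : 0 < c) : EigenvaluesZeroOrPosRe (c • A) := by
  intro μ hμ
  have hc' : (c : ℂ) ≠ 0 := by exact_mod_cast hc.ne'
  have e : (c • A).map (algebraMap ℝ ℂ) = (Units.mk0 (c : ℂ) hc') • A.map (algebraMap ℝ ℂ) := by
    ext i j
    simp [Units.smul_def]
  have e2 : μ = (Units.mk0 (c : ℂ) hc') • ((c : ℂ)⁻¹ * μ) := by
    rw [Units.smul_def, Units.val_mk0, smul_eq_mul, mul_inv_cancel_left₀ hc']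
  rw [e, e2, spectrum.smul_mem_smul_iff] at hμ
  rcases hA _ hμ with h | h
  · left
    rw [e2, h, smul_zero]
  · right
    rw [e2, Units.smul_def, Units.val_mk0, smul_eq_mul, Complex.re_ofReal_mul]
    exact mul_pos hc h

/-- If all eigenvalues of `A` are zero or have positive real part, then `A z → 0` for every bounded
curve with `z' + A z → 0`. -/
theorem EigenvaluesZeroOrPosRe.tendsto_mulVec_zero {A : Matrix κ κ ℝ}
    (hA : EigenvaluesZeroOrPosRe A) {z z' : ℝ → κ → ℝ} {C : ℝ}
    (hz : ∀ t, 0 < t → HasDerivAt z (z' t) t) (hC : ∀ t, 0 ≤ t → ‖z t‖ ≤ C)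
    (h : Tendsto (fun t => z' t + A *ᵥ z t) atTop (𝓝 0)) :
    Tendsto (fun t => A *ᵥ z t) atTop (𝓝 0) := by
  set B := A.map (algebraMap ℝ ℂ) with hB
  have hmap : ∀ x : κ → ℝ, B *ᵥ (fun i => (x i : ℂ)) = fun i => ((A *ᵥ x) i : ℂ) := by
    intro x
    ext i
    simp [hB, Matrix.mulVec, dotProduct]
  have key := tendsto_mulVec_zero_of_prod B B.charpoly.roots
    (fun μ hμ => hA μ (Matrix.mem_spectrum_iff_isRoot_charpoly.2 (isRoot_of_mem_roots hμ)))
    (fun t i => (z t i : ℂ)) (fun t i => (z' t i : ℂ)) C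
    (fun t ht => hasDerivAt_pi.2 fun i => (hasDerivAt_pi.1 (hz t ht) i).ofReal_comp)
    (fun t ht => by
      have hC0 : 0 ≤ C := (norm_nonneg _).trans (hC t ht)
      refine (pi_norm_le_iff_of_nonneg hC0).2 fun i => ?_
      rw [Complex.norm_real]
      exact (norm_le_pi_norm _ i).trans (hC t ht))
    (by
      rw [tendsto_pi_nhds] at h ⊢
      intro i
      have := (Complex.continuous_ofReal.tendsto 0).comp (h i)
      rw [Complex.ofReal_zero] at this
      refine this.congr fun t => ?_
      simp [hmap])
    (by
      -- Cayley–Hamilton: the product over all roots annihilates `B` exactly.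
      have hs := (IsAlgClosed.splits B.charpoly).eq_prod_roots_of_monic B.charpoly_monic
      rw [← hs, Matrix.aeval_self_charpoly]
      simp)
  rw [tendsto_pi_nhds] at key ⊢
  intro i
  have := (Complex.continuous_re.tendsto 0).comp (key i)
  rw [Complex.zero_re] at this
  refine this.congr fun t => ?_
  simp [hmap]

end Modes

/-! ### Global solutions of Lipschitz equations. -/

section GlobalExistence

open Set Filter
open scoped NNReal

variable {X : Type*} [NormedAddCommGroup X] [NormedSpace ℝ X]

/-- At the junction both one-sided derivatives equal `F` at the common value. Away from it one of
the two intervals is at positive distance and imposes no condition. -/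
theorem hasDerivWithinAt_concat {F : X → X} {φ ψ : ℝ → X} {a b : ℝ} (ha : 0 ≤ a) (hb : 0 ≤ b)
    (hφ : ∀ t ∈ Icc 0 a, HasDerivWithinAt φ (F (φ t)) (Icc 0 a) t)
    (hψ : ∀ t ∈ Icc 0 b, HasDerivWithinAt ψ (F (ψ t)) (Icc 0 b) t) (h : ψ 0 = φ a) :
    ∃ χ : ℝ → X, χ 0 = φ 0 ∧
      ∀ t ∈ Icc 0 (a + b), HasDerivWithinAt χ (F (χ t)) (Icc 0 (a + b)) t := by
  set χ : ℝ → X := fun t => if t ≤ a then φ t else ψ (t - a) with hχ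
  have hχl : ∀ t ≤ a, χ t = φ t := fun t ht => if_pos ht
  have hχr : ∀ t, a ≤ t → χ t = ψ (t - a) := by
    intro t ht
    rcases ht.eq_or_lt with rfl | ht
    · rw [hχl _ le_rfl, sub_self, h]
    · exact if_neg (not_le.2 ht)
  have hl : ∀ t ∈ Icc 0 a, HasDerivWithinAt χ (F (χ t)) (Icc 0 a) t := fun t ht => by
    rw [hχl t ht.2]
    exact (hφ t ht).congr (fun s hs => hχl s hs.2) (hχl t ht.2)
  have hr : ∀ t ∈ Icc a (a + b), HasDerivWithinAt χ (F (χ t)) (Icc a (a + b)) t := fun t ht => by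
    rw [hχr t ht.1]
    have h1 := (hψ (t - a) ⟨by linarith [ht.1], by linarith [ht.2]⟩).scomp t
      ((hasDerivAt_id t).sub_const a).hasDerivWithinAt
      (show MapsTo (fun s => id s - a) (Icc a (a + b)) (Icc 0 b) from fun s hs =>
        ⟨by simp only [id]; linarith [hs.1], by simp only [id]; linarith [hs.2]⟩)
    rw [one_smul] at h1
    exact h1.congr (fun s hs => hχr s hs.1) (hχr t ht.1)
  refine ⟨χ, hχl 0 ha, fun t ht => ?_⟩
  have hU : Icc 0 (a + b) = Icc 0 a ∪ Icc a (a + b) :=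
    (Icc_union_Icc_eq_Icc ha (by linarith)).symm
  rw [hU]
  rcases lt_trichotomy t a with hta | rfl | hta
  · refine (hl t ⟨ht.1, hta.le⟩).union ?_
    exact HasFDerivWithinAt.of_notMem_closure (by
      rw [isClosed_Icc.closure_eq]
      exact fun hh => absurd hh.1 (not_le.2 hta))
  · exact (hl t ⟨ha, le_rfl⟩).union (hr t ⟨le_rfl, by linarith⟩)
  · refine HasDerivWithinAt.union ?_ (hr t ⟨hta.le, ht.2⟩)
    exact HasFDerivWithinAt.of_notMem_closure (by
      rw [isClosed_Icc.closure_eq]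
      exact fun hh => absurd hh.2 (not_le.2 hta))

/-- Solutions of a globally Lipschitz equation exist on a time interval whose length depends only
on the Lipschitz constant. -/
theorem exists_solution_Icc_of_lipschitz [CompleteSpace X] {F : X → X} {K : ℝ≥0} (hF : LipschitzWith K F) (p : X) :
    ∃ φ : ℝ → X, φ 0 = p ∧ ∀ t ∈ Icc (0 : ℝ) (1 / (1 + K)),
      HasDerivWithinAt φ (F (φ t)) (Icc 0 (1 / (1 + K))) t := by
  have hτ : (0 : ℝ) ≤ 1 / (1 + K) := by positivity
  -- On the ball of radius `‖F p‖ + 1` the speed is at most `(1 + K)(‖F p‖ + 1)`; in time `1 / (1 +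
  -- K)` a solution cannot leave it.
  have hPL : IsPicardLindelof (fun _ => F) (⟨0, le_rfl, hτ⟩ : Icc (0 : ℝ) (1 / (1 + K))) p
      (‖F p‖₊ + 1) 0 ((1 + K) * (‖F p‖₊ + 1)) K := by
    refine .of_time_independent (fun x hx => ?_) hF.lipschitzOnWith ?_
    · have h1 : ‖F x - F p‖ ≤ K * (‖F p‖ + 1) := by
        rw [← dist_eq_norm]
        refine (hF.dist_le_mul x p).trans (mul_le_mul_of_nonneg_left ?_ K.2)
        simpa using hx
      have h2 : ‖F x‖ ≤ ‖F x - F p‖ + ‖F p‖ := by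
        simpa using norm_add_le (F x - F p) (F p)
      push_cast
      linarith
    · push_cast
      have h3 : max ((1 : ℝ) / (1 + K) - 0) (0 - 0) = 1 / (1 + K) := by
        rw [sub_zero, sub_zero, max_eq_left hτ]
      simp only [h3]
      rw [sub_zero]
      field_simp
      exact le_rfl
  exact hPL.exists_eq_forall_mem_Icc_hasDerivWithinAt₀

theorem exists_solution_Icc_nat_of_lipschitz [CompleteSpace X] {F : X → X} {K : ℝ≥0} (hF : LipschitzWith K F)
    (p : X) (j : ℕ) : ∃ φ : ℝ → X, φ 0 = p ∧ ∀ t ∈ Icc (0 : ℝ) (j * (1 / (1 + K))),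
      HasDerivWithinAt φ (F (φ t)) (Icc 0 (j * (1 / (1 + K)))) t := by
  induction j with
  | zero =>
    refine ⟨fun _ => p, rfl, fun t ht => ?_⟩
    have h0 : Icc (0 : ℝ) ((0 : ℕ) * (1 / (1 + (K : ℝ)))) = {0} := by simp
    rw [h0] at ht ⊢
    rw [mem_singleton_iff.1 ht]
    exact HasFDerivWithinAt.of_subsingleton subsingleton_singleton
  | succ j ih =>
    obtain ⟨φ, h0, hφ⟩ := ih
    obtain ⟨ψ, hψ0, hψ⟩ := exists_solution_Icc_of_lipschitz hF (φ (j * (1 / (1 + K))))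
    obtain ⟨χ, hχ0, hχ⟩ := hasDerivWithinAt_concat (by positivity) (by positivity) hφ hψ hψ0
    refine ⟨χ, hχ0.trans h0, ?_⟩
    have e : ((j + 1 : ℕ) : ℝ) * (1 / (1 + (K : ℝ))) = j * (1 / (1 + K)) + 1 / (1 + K) := by
      push_cast
      ring
    rw [e]
    exact hχ

/-- A globally Lipschitz autonomous equation has solutions on `[0, ∞)`. -/
theorem exists_isSolution_of_lipschitz [CompleteSpace X] {F : X → X} {K : ℝ≥0} (hF : LipschitzWith K F) (p : X) :
    ∃ φ, IsSolution F φ ∧ φ 0 = p := by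
  choose φ h0 hφ using exists_solution_Icc_nat_of_lipschitz hF p
  set τ : ℝ := 1 / (1 + K)
  have hτ : 0 < τ := by positivity
  have hagree : ∀ i j : ℕ, i ≤ j → EqOn (φ i) (φ j) (Icc 0 (i * τ)) := by
    intro i j hij
    have hsub : (i : ℝ) * τ ≤ j * τ := mul_le_mul_of_nonneg_right (by exact_mod_cast hij) hτ.le
    have hder : ∀ m : ℕ, (i : ℝ) * τ ≤ m * τ → ∀ t ∈ Ico (0 : ℝ) (i * τ),
        HasDerivWithinAt (φ m) (F (φ m t)) (Ici t) t := fun m hm t ht =>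
      (hφ m t ⟨ht.1, ht.2.le.trans hm⟩).mono_of_mem_nhdsWithin
        (Filter.mem_of_superset (Icc_mem_nhdsGE (ht.2.trans_le hm))
          (Icc_subset_Icc_left ht.1))
    exact ODE_solution_unique (v := fun _ => F) (fun _ => hF)
      (fun t ht => (hφ i t ht).continuousWithinAt) (hder i le_rfl)
      (fun t ht => ((hφ j t ⟨ht.1, ht.2.trans hsub⟩).mono
        (Icc_subset_Icc_right hsub)).continuousWithinAt) (hder j hsub) ((h0 i).trans (h0 j).symm)
  set N : ℝ → ℕ := fun t => ⌈t / τ⌉₊ with hN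
  have hNt : ∀ t, t ≤ N t * τ := fun t => (div_le_iff₀ hτ).1 (Nat.le_ceil _)
  refine ⟨fun t => φ (N t) t, fun t ht => ?_, h0 _⟩
  -- The extra unit puts `t` strictly before the end of the interval, so that it contains a right
  -- neighbourhood of `t`.
  set j := N t + 1
  have htj : t < j * τ := by
    have := hNt t
    have e : (j : ℝ) * τ = N t * τ + τ := by
      simp only [j]; push_cast; ring
    linarith
  have heq : ∀ s ∈ Icc 0 (j * τ), φ (N s) s = φ j s := fun s hs =>
    hagree (N s) j (Nat.ceil_le.2 ((div_le_iff₀ hτ).2 hs.2)) ⟨hs.1, hNt s⟩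
  have h1 : HasDerivWithinAt (fun s => φ (N s) s) (F (φ (N t) t)) (Icc 0 (j * τ)) t := by
    rw [heq t ⟨ht, htj.le⟩]
    exact (hφ j t ⟨ht, htj.le⟩).congr heq (heq t ⟨ht, htj.le⟩)
  refine h1.mono_of_mem_nhdsWithin ?_
  rw [← Ici_inter_Iic]
  exact inter_mem_nhdsWithin _ (Iic_mem_nhds htj)

end GlobalExistence

/-! ### Strong convexity and the minimizer of the total objective. -/

section Convex

variable {n : ℕ}

theorem inner_gradient_eq_fderiv {f : Vec n → ℝ} (x d : Vec n) :
    inner ℝ (gradient f x) d = fderiv ℝ f x d := by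
  exact inner_gradient_left

/-- The first-order characterization of strong convexity. -/
theorem _root_.StrongConvexOn.gradient_add_sq_le {f : Vec n → ℝ} {m : ℝ}
    (hf : StrongConvexOn Set.univ m f) (hd : Differentiable ℝ f) (x y : Vec n) :
    f x + inner ℝ (gradient f x) (y - x) + m / 2 * ‖y - x‖ ^ 2 ≤ f y := by
  set d := y - x with hdd
  -- Removing the quadratic leaves a convex function. The claim is its tangent inequality at `x`
  -- along the segment to `y`, with the squares expanded.
  have hconv : ConvexOn ℝ Set.univ fun t : ℝ =>
      f (x + t • d) - m / 2 * ‖x + t • d‖ ^ 2 := by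
    have := (strongConvexOn_iff_convex.1 hf).comp_affineMap (AffineMap.lineMap x y)
    rw [Set.preimage_univ] at this
    have e : (fun t : ℝ => f (x + t • d) - m / 2 * ‖x + t • d‖ ^ 2) =
        (fun x => f x - m / 2 * ‖x‖ ^ 2) ∘ AffineMap.lineMap x y := by
      ext t
      simp only [Function.comp, AffineMap.lineMap_apply_module', hdd, add_comm]
    rw [e]
    exact this
  have hline : HasDerivAt (fun t : ℝ => x + t • d) d 0 := by
    simpa using (((hasDerivAt_id (0 : ℝ)).smul_const d).const_add x)
  have hder : HasDerivAt (fun t : ℝ => f (x + t • d) - m / 2 * ‖x + t • d‖ ^ 2)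
      (inner ℝ (gradient f x) d - m / 2 * (2 * inner ℝ x d)) 0 := by
    have h1 : HasDerivAt (fun t : ℝ => f (x + t • d)) (fderiv ℝ f x d) 0 := by
      have h2 : HasFDerivAt f (fderiv ℝ f x) (x + (0 : ℝ) • d) := by
        rw [zero_smul, add_zero]
        exact (hd x).hasFDerivAt
      exact h2.comp_hasDerivAt 0 hline
    rw [inner_gradient_eq_fderiv]
    have h3 := hline.norm_sq
    simp only [zero_smul, add_zero] at h3
    exact h1.sub (h3.const_mul _)
  have h := hconv.le_slope_of_hasDerivAt (Set.mem_univ 0) (Set.mem_univ 1) one_pos hder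
  rw [slope_def_field] at h
  simp only [one_smul, zero_smul, add_zero, sub_zero, div_one] at h
  have e : x + d = y := by rw [hdd]; abel
  rw [e] at h
  have e2 : ‖y‖ ^ 2 = ‖x‖ ^ 2 + 2 * inner ℝ x d + ‖d‖ ^ 2 := by
    rw [← e, norm_add_sq_real]
  rw [e2] at h
  linarith

/-- The gradient of a strongly convex function is strongly monotone. -/
theorem _root_.StrongConvexOn.gradient_strongly_monotone {f : Vec n → ℝ} {m : ℝ}
    (hf : StrongConvexOn Set.univ m f) (hd : Differentiable ℝ f) (x y : Vec n) :
    m * ‖y - x‖ ^ 2 ≤ inner ℝ (y - x) (gradient f y - gradient f x) := by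
  have h1 := hf.gradient_add_sq_le hd x y
  have h2 := hf.gradient_add_sq_le hd y x
  rw [← neg_sub y x, norm_neg, inner_neg_right] at h2
  rw [inner_sub_right, real_inner_comm (gradient f y), real_inner_comm (gradient f x)]
  linarith

variable {ι : Type*} [Fintype ι]

theorem sum_gradient_add_sq_le {f : ι → Vec n → ℝ} {m : ι → ℝ}
    (hf : ∀ i, StrongConvexOn Set.univ (m i) (f i)) (hd : ∀ i, Differentiable ℝ (f i))
    (x y : Vec n) :
    ∑ i, f i x + inner ℝ (∑ i, gradient (f i) x) (y - x) + (∑ i, m i) / 2 * ‖y - x‖ ^ 2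
      ≤ ∑ i, f i y := by
  rw [sum_inner, Finset.sum_div, Finset.sum_mul, ← Finset.sum_add_distrib,
    ← Finset.sum_add_distrib]
  exact Finset.sum_le_sum fun i _ => (hf i).gradient_add_sq_le (hd i) x y

theorem sum_lt_sum_of_sum_gradient_eq_zero {f : ι → Vec n → ℝ} {m : ι → ℝ}
    (hm : 0 < ∑ i, m i)
    (hf : ∀ i, StrongConvexOn Set.univ (m i) (f i)) (hd : ∀ i, Differentiable ℝ (f i))
    {x y : Vec n} (hx : ∑ i, gradient (f i) x = 0) (hxy : y ≠ x) :
    ∑ i, f i x < ∑ i, f i y := by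
  have h := sum_gradient_add_sq_le hf hd x y
  rw [hx, inner_zero_left] at h
  have : 0 < ‖y - x‖ := norm_pos_iff.2 (sub_ne_zero.2 hxy)
  have : 0 < (∑ i, m i) / 2 * ‖y - x‖ ^ 2 := by positivity
  linarith

/-- The quadratic lower bound at `0` confines the sublevel set of `0` to a ball, so a minimizer
exists by compactness, and its gradient vanishes. -/
theorem exists_sum_gradient_eq_zero {f : ι → Vec n → ℝ} {m : ι → ℝ} (hm : 0 < ∑ i, m i)
    (hf : ∀ i, StrongConvexOn Set.univ (m i) (f i)) (hd : ∀ i, Differentiable ℝ (f i)) :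
    ∃ y, ∑ i, gradient (f i) y = 0 := by
  have hcont : Continuous fun y => ∑ i, f i y :=
    continuous_finsetSum _ fun i _ => (hd i).continuous
  obtain ⟨y, hy⟩ := hcont.exists_forall_le_of_isBounded 0 (by
    refine (Metric.isBounded_closedBall (x := (0 : Vec n))
      (r := 2 * ‖∑ i, gradient (f i) 0‖ / ∑ i, m i)).subset fun y hy => ?_
    have hy' : ∑ i, f i y ≤ ∑ i, f i 0 := hy
    have h1 := sum_gradient_add_sq_le hf hd 0 y
    rw [sub_zero] at h1
    have h2 := neg_le_of_abs_le (abs_real_inner_le_norm (∑ i, gradient (f i) 0) y)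
    rw [mem_closedBall_zero_iff, le_div_iff₀ hm]
    rcases (norm_nonneg y).eq_or_lt with h0 | h0
    · rw [← h0, zero_mul]
      positivity
    · by_contra hcon
      have := mul_lt_mul_of_pos_right (not_le.1 hcon) h0
      nlinarith)
  refine ⟨y, ?_⟩
  have hmin : IsLocalMin (fun y => ∑ i, f i y) y := Filter.Eventually.of_forall hy
  have h3 := hmin.fderiv_eq_zero
  rw [fderiv_fun_sum fun i _ => (hd i).differentiableAt] at h3
  refine ext_inner_right ℝ fun d => ?_
  rw [sum_inner, inner_zero_left]
  simp only [inner_gradient_eq_fderiv]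
  have := congrArg (fun L : Vec n →L[ℝ] ℝ => L d) h3
  simpa using this

end Convex

/-! ### Passivity of a single agent. -/

section Passivity

variable {n : ℕ}

theorem gradient_storage (a : ℝ) (x xbar : Vec n) :
    gradient (fun x' => 1 / (2 * a) * inner ℝ (x' - xbar) (x' - xbar)) x
      = (1 / a) • (x - xbar) := by
  refine ext_inner_right ℝ fun d => ?_
  rw [inner_gradient_eq_fderiv, real_inner_smul_left]
  have h1 : HasFDerivAt (fun x' : Vec n => x' - xbar) (ContinuousLinearMap.id ℝ (Vec n)) x :=
    (hasFDerivAt_id x).sub_const _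
  rw [((h1.inner ℝ h1).const_mul (1 / (2 * a))).fderiv]
  simp only [_root_.smul_apply, ContinuousLinearMap.comp_apply,
    ContinuousLinearMap.prod_apply, ContinuousLinearMap.id_apply, fderivInnerCLM_apply,
    smul_eq_mul]
  rw [real_inner_comm (x - xbar) d]
  -- For `a = 0` both coefficients are `0`, by the convention for division by zero.
  rcases eq_or_ne a 0 with rfl | ha
  · simp
  · field_simp
    ring

/-- The dissipation inequality of a passive agent, in terms of inner products. -/
theorem AgentIsISOSEIP.inner_le {a g ν ρ : ℝ} {f : Vec n → ℝ} (h : AgentIsISOSEIP a g f ν ρ)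
    {xbar ubar : Vec n} (hbar : agentDynamics a g f xbar ubar = 0) (x u : Vec n) :
    1 / a * inner ℝ (x - xbar) (agentDynamics a g f x u) ≤
      passivitySupply ν ρ (u - ubar) (agentOutput g x u - agentOutput g xbar ubar) := by
  have := h.dissipation x u xbar ubar hbar
  rwa [gradient_storage, real_inner_smul_left] at this

theorem agentDynamics_eq_smul (a g : ℝ) (f : Vec n → ℝ) (x u : Vec n) :
    agentDynamics a g f x u = a • (u - gradient f (agentOutput g x u)) := by
  simp only [agentDynamics, agentOutput, smul_sub]
  abel

theorem agentDynamics_eq_zero_iff {a : ℝ} (ha : a ≠ 0) {g : ℝ} {f : Vec n → ℝ} {x u : Vec n} :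
    agentDynamics a g f x u = 0 ↔ gradient f (agentOutput g x u) = u := by
  rw [agentDynamics_eq_smul, smul_eq_zero_iff_right ha, sub_eq_zero, eq_comm]

/-- With `x̃ = ỹ - gũ` and `D` the gradient error, the storage rate is `⟨ỹ - gũ, ũ - D⟩`. Strong
monotonicity bounds `⟨ỹ, D⟩` below by `m‖ỹ‖²`. Young's inequality and the Lipschitz bound give `g⟨ũ,
D⟩ ≤ (g/2)(‖ũ‖² + l²‖ỹ‖²)`, which produces both indices. -/
theorem agentIsISOSEIP_of_strongConvexOn {a g m : ℝ} {l : NNReal} {f : Vec n → ℝ} (ha : 0 < a)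
    (hg : 0 ≤ g) (hd : Differentiable ℝ f) (hf : StrongConvexOn Set.univ m f)
    (hl : LipschitzWith l (gradient f)) :
    AgentIsISOSEIP a g f (1 / 2 * g) (m - 1 / 2 * g * (l : ℝ) ^ 2) where
  contDiff xbar ubar _ :=
    contDiff_const.mul ((contDiff_id.sub contDiff_const).inner ℝ (contDiff_id.sub contDiff_const))
  eq_zero xbar ubar _ := by simp
  nonneg x xbar ubar _ := mul_nonneg (by positivity) real_inner_self_nonneg
  dissipation x u xbar ubar hbar := by
    rw [gradient_storage, real_inner_smul_left, agentDynamics_eq_smul, real_inner_smul_right]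
    rw [agentDynamics_eq_zero_iff ha.ne'] at hbar
    set y := agentOutput g x u with hy
    set ybar := agentOutput g xbar ubar with hybar
    have hx : x - xbar = (y - ybar) - g • (u - ubar) := by
      simp only [hy, hybar, agentOutput, smul_sub]
      abel
    have hu : u - gradient f y = (u - ubar) - (gradient f y - gradient f ybar) := by
      rw [hbar]
      abel
    have hmono := hf.gradient_strongly_monotone hd ybar y
    have hlip := hl.dist_le_mul y ybar
    rw [dist_eq_norm, dist_eq_norm] at hlip
    rw [← mul_assoc, one_div, inv_mul_cancel₀ ha.ne', one_mul, hx, hu]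
    set Y := y - ybar
    set U := u - ubar
    set D := gradient f y - gradient f ybar
    have hlip2 : ‖D‖ ^ 2 ≤ (l : ℝ) ^ 2 * ‖Y‖ ^ 2 := by
      rw [← mul_pow]
      exact pow_le_pow_left₀ (norm_nonneg _) hlip 2
    have hUD : 2 * inner ℝ U D ≤ ‖U‖ ^ 2 + ‖D‖ ^ 2 := by
      have := sq_nonneg ‖U - D‖
      rw [norm_sub_sq_real] at this
      linarith
    have hUD2 := mul_le_mul_of_nonneg_left (hUD.trans (add_le_add_right hlip2 _)) hg
    simp only [passivitySupply, inner_sub_left, inner_sub_right, real_inner_smul_left,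
      real_inner_self_eq_norm_sq]
    linarith

end Passivity

/-! ### Kernel conditions, the dissipation form and the slow dynamics. -/

section LinearAlgebra

open Filter

variable {ι κ : Type*} [Fintype ι]

theorem HasNullspaceProperty.mem_iff {R : Matrix ι κ ℝ} (hR : HasNullspaceProperty R)
    (v : ι → ℝ) : Rᵀ *ᵥ v = 0 ↔ ∃ a : ℝ, ∀ i, v i = a := by
  have h : v ∈ LinearMap.ker (Rᵀ).mulVecLin ↔ v ∈ Submodule.span ℝ {(1 : ι → ℝ)} := by rw [hR]
  rw [LinearMap.mem_ker, Matrix.mulVecLin_apply, Submodule.mem_span_singleton] at h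
  rw [h]
  refine exists_congr fun a => ?_
  rw [funext_iff]
  simp [eq_comm]

theorem HasNullspaceProperty.sum_mulVec [Fintype κ] {R : Matrix ι κ ℝ} (hR : HasNullspaceProperty R)
    (z : κ → ℝ) : ∑ i, (R *ᵥ z) i = 0 := by
  have h1 : Rᵀ *ᵥ (1 : ι → ℝ) = 0 := (hR.mem_iff 1).2 ⟨1, fun _ => rfl⟩
  have h2 : (1 : ι → ℝ) ⬝ᵥ R *ᵥ z = 0 := by
    rw [Matrix.dotProduct_mulVec, ← Matrix.mulVec_transpose, h1, zero_dotProduct]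
  simpa [dotProduct] using h2

/-- The range of `R` is the annihilator of `ker Rᵀ`: a functional vanishing on the range has
constant coefficients, so it also kills every vector of zero sum. -/
theorem HasNullspaceProperty.exists_mulVec_eq [Fintype κ] {R : Matrix ι κ ℝ}
    (hR : HasNullspaceProperty R) {b : ι → ℝ} (hb : ∑ i, b i = 0) : ∃ z, R *ᵥ z = b := by
  classical
  by_contra hcon
  have hb' : b ∉ LinearMap.range R.mulVecLin := fun ⟨z, hz⟩ => hcon ⟨z, hz⟩
  obtain ⟨g, hgb, hg⟩ := Submodule.exists_le_ker_of_notMem hb'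
  have hgv : ∀ v : ι → ℝ, g v = (fun i => g (Pi.single i 1)) ⬝ᵥ v := by
    intro v
    conv_lhs => rw [pi_eq_sum_univ' v]
    simp [dotProduct, mul_comm]
  have h0 : Rᵀ *ᵥ (fun i => g (Pi.single i 1)) = 0 := by
    refine dotProduct_eq_zero _ fun z => ?_
    rw [Matrix.mulVec_transpose, ← Matrix.dotProduct_mulVec, ← hgv]
    exact hg ⟨z, rfl⟩
  obtain ⟨a, ha⟩ := (hR.mem_iff _).1 h0
  apply hgb
  rw [hgv, dotProduct]
  simp only [ha, ← Finset.mul_sum, hb, mul_zero]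

/-- A positive semidefinite real matrix is a Gram matrix. -/
theorem _root_.Matrix.PosSemidef.exists_eq_transpose_mul_self [DecidableEq ι]
    {A : Matrix ι ι ℝ} (hA : A.PosSemidef) : ∃ B : Matrix ι ι ℝ, A = Bᵀ * B := by
  open scoped MatrixOrder in
  obtain ⟨B, hB⟩ := CStarAlgebra.nonneg_iff_eq_star_mul_self.mp hA.nonneg
  exact ⟨B, by rw [hB, Matrix.star_eq_conjTranspose, Matrix.conjTranspose_eq_transpose_of_trivial]⟩

variable [Fintype κ] [DecidableEq ι]

/-- The quadratic form of the stability matrix is the dissipation of the interconnection. -/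
theorem dotProduct_stabilityMatrix (ν ρ : ι → ℝ) (RN RK : Matrix ι κ ℝ) (y : ι → ℝ) (z : κ → ℝ) :
    Sum.elim y z ⬝ᵥ stabilityMatrix ν ρ RN RK *ᵥ Sum.elim y z =
      2 * (∑ i, (ρ i * (y i * y i) + ν i * ((RK *ᵥ z) i * (RK *ᵥ z) i) + y i * (RK *ᵥ z) i)
        - z ⬝ᵥ RNᵀ *ᵥ y) := by
  have h1 : y ⬝ᵥ matK ρ *ᵥ y = ∑ i, ρ i * (y i * y i) := by
    simp only [matK, dotProduct, Matrix.mulVec_diagonal]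
    exact Finset.sum_congr rfl fun i _ => by ring
  have h2 : z ⬝ᵥ matL ν RK *ᵥ z = ∑ i, ν i * ((RK *ᵥ z) i * (RK *ᵥ z) i) := by
    rw [matL, ← Matrix.mulVec_mulVec, ← Matrix.mulVec_mulVec, Matrix.dotProduct_mulVec,
      Matrix.vecMul_transpose]
    simp only [dotProduct, Matrix.mulVec_diagonal]
    exact Finset.sum_congr rfl fun i _ => by ring
  have h3 : ∀ R : Matrix ι κ ℝ, z ⬝ᵥ Rᵀ *ᵥ y = y ⬝ᵥ R *ᵥ z := fun R => by
    rw [Matrix.dotProduct_mulVec, Matrix.vecMul_transpose, dotProduct_comm]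
  rw [stabilityMatrix, Matrix.fromBlocks_mulVec, sumElim_dotProduct_sumElim]
  simp only [Function.comp_def, Sum.elim_inl, Sum.elim_inr]
  rw [dotProduct_add, dotProduct_add, h3, Matrix.smul_mulVec, Matrix.smul_mulVec, dotProduct_smul,
    dotProduct_smul, h1, h2, h3, Matrix.sub_mulVec, dotProduct_sub, Finset.sum_add_distrib,
    Finset.sum_add_distrib]
  simp only [smul_eq_mul]
  rw [show y ⬝ᵥ RK *ᵥ z = ∑ i, y i * (RK *ᵥ z) i from rfl]
  ring

/-- One coordinate of the slow dynamics: if the controller states are bounded and driven by `y`,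
and `2 K y + (R_K - R_N) z` vanishes asymptotically, then so do `y` and the derivative of `z`. -/
theorem tendsto_zero_of_slow_dynamics [DecidableEq κ] {β : κ → ℝ} {ρ : ι → ℝ} {RN RK : Matrix ι κ ℝ}
    (hβ : ∀ k, 0 < β k) (hρ : ∀ i, 0 < ρ i)
    (hRN : HasNullspaceProperty RN) (hRK : HasNullspaceProperty RK)
    (heig : EigenvaluesZeroOrPosRe (slowMatrix β ρ RN RK))
    {y : ℝ → ι → ℝ} {z : ℝ → κ → ℝ} {C : ℝ}
    (hz : ∀ t, 0 < t → HasDerivAt z (Matrix.diagonal β *ᵥ RNᵀ *ᵥ y t) t)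
    (hC : ∀ t, 0 ≤ t → ‖z t‖ ≤ C)
    (he : Tendsto (fun t => (2 : ℝ) • matK ρ *ᵥ y t + (RK - RN) *ᵥ z t) atTop (𝓝 0)) :
    Tendsto y atTop (𝓝 0) := by
  -- Solving `he` for `y` gives `y ≈ -½ K⁻¹ (R_K - R_N) z`; substituting this in `z'` produces `-A
  -- z`.
  set A := (1 / 2 : ℝ) • slowMatrix β ρ RN RK with hA
  have hKinv : (matK ρ)⁻¹ * matK ρ = 1 := by
    refine Matrix.nonsing_inv_mul _ ?_
    rw [matK, Matrix.det_diagonal]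
    exact (Finset.prod_pos fun i _ => hρ i).ne'.isUnit
  have hzA : Tendsto (fun t => Matrix.diagonal β *ᵥ RNᵀ *ᵥ y t + A *ᵥ z t) atTop (𝓝 0) := by
    have h := ((continuous_mulVec ((1 / 2 : ℝ) • (Matrix.diagonal β * RNᵀ * (matK ρ)⁻¹))).tendsto
      0).comp he
    rw [Matrix.mulVec_zero] at h
    refine h.congr fun t => ?_
    have h1 : (Matrix.diagonal β * RNᵀ * (matK ρ)⁻¹) *ᵥ matK ρ *ᵥ y t
        = Matrix.diagonal β *ᵥ RNᵀ *ᵥ y t := by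
      rw [Matrix.mulVec_mulVec, Matrix.mul_assoc, hKinv, Matrix.mul_one, Matrix.mulVec_mulVec]
    rw [Function.comp, Matrix.smul_mulVec, Matrix.mulVec_add, Matrix.mulVec_smul, h1,
      Matrix.mulVec_mulVec, smul_add, smul_smul, hA, Matrix.smul_mulVec, slowMatrix]
    norm_num
  have hAz := (heig.smul (by norm_num : (0 : ℝ) < 1 / 2)).tendsto_mulVec_zero hz hC hzA
  have hβy : Tendsto (fun t => Matrix.diagonal β *ᵥ RNᵀ *ᵥ y t) atTop (𝓝 0) := by
    have := hzA.sub hAz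
    simpa only [← hA, add_sub_cancel_right, sub_zero] using this
  have hRy : Tendsto (fun t => RNᵀ *ᵥ y t) atTop (𝓝 0) := by
    rw [tendsto_pi_nhds] at hβy ⊢
    intro k
    have := (hβy k).const_mul (β k)⁻¹
    simp only [Matrix.mulVec_diagonal, Pi.zero_apply, mul_zero] at this
    exact this.congr fun t => inv_mul_cancel_left₀ (hβ k).ne' _
  -- Summing `he` over the agents removes `R_K` and `R_N`, whose columns have zero sum.
  have hsum : Tendsto (fun t => ∑ i, ρ i * y t i) atTop (𝓝 0) := by
    have h : Tendsto (fun t => ∑ i, ((2 : ℝ) • matK ρ *ᵥ y t + (RK - RN) *ᵥ z t) i) atTop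
        (𝓝 (∑ i : ι, (0 : ι → ℝ) i)) := tendsto_finsetSum _ fun i _ => tendsto_pi_nhds.1 he i
    have h' := h.const_mul (1 / 2 : ℝ)
    simp only [Pi.zero_apply, Finset.sum_const_zero, mul_zero] at h'
    refine h'.congr fun t => ?_
    simp only [Matrix.sub_mulVec, Pi.add_apply, Pi.sub_apply, Finset.sum_add_distrib,
      Finset.sum_sub_distrib, hRK.sum_mulVec, hRN.sum_mulVec, Pi.smul_apply, smul_eq_mul,
      matK, Matrix.mulVec_diagonal, ← Finset.mul_sum]
    ring
  -- `R_Nᵀ` loses only constant vectors, and the `ρ`-weighted sum detects those because the weights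
  -- are positive. So `T` is injective, and a continuous left inverse recovers `y`.
  let T : (ι → ℝ) →ₗ[ℝ] (κ → ℝ) × ℝ :=
    (RNᵀ).mulVecLin.prod (∑ i, ρ i • LinearMap.proj i)
  have hT : ∀ v, T v = (RNᵀ *ᵥ v, ∑ i, ρ i * v i) := fun v => by
    simp [T, Matrix.mulVec_transpose]
  have hker : LinearMap.ker T = ⊥ := by
    rw [LinearMap.ker_eq_bot']
    intro v hv
    rw [hT, Prod.mk_eq_zero] at hv
    obtain ⟨a, ha⟩ := (hRN.mem_iff v).1 hv.1
    have h2 := hv.2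
    simp only [ha, ← Finset.sum_mul] at h2
    ext i
    have hpos : 0 < ∑ i, ρ i := Finset.sum_pos (fun i _ => hρ i) ⟨i, Finset.mem_univ i⟩
    rw [ha i]
    exact (mul_eq_zero.1 h2).resolve_left hpos.ne'
  obtain ⟨S, hS⟩ := T.exists_leftInverse_of_injective hker
  have hlim := (S.continuous_of_finiteDimensional.tendsto (0, 0)).comp
    (hRy.prodMk_nhds hsum)
  rw [Prod.mk_zero_zero, map_zero] at hlim
  refine hlim.congr fun t => ?_
  rw [Function.comp, ← hT]
  exact LinearMap.congr_fun hS (y t)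

end LinearAlgebra

/-! ### Equilibria and Lyapunov function of the closed loop. -/

noncomputable section ClosedLoop

open Filter Set

theorem sum_smul_coord {ι κ : Type*} [Fintype ι] {n : ℕ} (R : Matrix ι κ ℝ) (y : ι → Vec n) (k : κ) (c : Fin n) :
    (∑ i, R i k • y i) c = (Rᵀ *ᵥ fun i => y i c) k := by
  simp [Matrix.mulVec, dotProduct]

variable {ι κ : Type*} [Fintype κ] {n : ℕ}

theorem inner_eq_sum_mul (x y : Vec n) : inner ℝ x y = ∑ c, x c * y c := by
  rw [PiLp.inner_apply]
  exact Finset.sum_congr rfl fun c _ => mul_comm _ _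

/-- The agent inputs as a linear function of the state. -/
def inputMap (RK : Matrix ι κ ℝ) : State ι κ n →ₗ[ℝ] (ι → Vec n) where
  toFun p := agentInput RK p
  map_add' p q := by
    ext1 i
    simp only [agentInput, Prod.snd_add, Pi.add_apply, smul_add, Finset.sum_add_distrib, neg_add]
  map_smul' a p := by
    ext1 i
    simp only [agentInput, Prod.smul_snd, Pi.smul_apply, RingHom.id_apply, smul_neg,
      Finset.smul_sum, smul_comm a]

/-- The agent outputs as a linear function of the state. -/
def outputMap (γ : ι → ℝ) (RK : Matrix ι κ ℝ) : State ι κ n →ₗ[ℝ] (ι → Vec n) where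
  toFun p := closedLoopOutput γ RK p
  map_add' p q := by
    have h := (inputMap RK).map_add p q
    ext1 i
    have hi : agentInput RK (p + q) i = agentInput RK p i + agentInput RK q i := congrFun h i
    simp only [closedLoopOutput, agentOutput, hi, Prod.fst_add, Pi.add_apply, smul_add]
    abel
  map_smul' a p := by
    have h := (inputMap RK).map_smul a p
    ext1 i
    have hi : agentInput RK (a • p) i = a • agentInput RK p i := congrFun h i
    simp only [closedLoopOutput, agentOutput, hi, Prod.smul_fst, Pi.smul_apply,
      RingHom.id_apply, smul_add, smul_comm a]

theorem outputMap_apply (γ : ι → ℝ) (RK : Matrix ι κ ℝ) (p : State ι κ n) (i : ι) :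
    outputMap γ RK p i = closedLoopOutput γ RK p i := rfl

theorem agentInput_coord (RK : Matrix ι κ ℝ) (p : State ι κ n) (i : ι) (c : Fin n) :
    agentInput RK p i c = -(RK *ᵥ fun k => p.2 k c) i := by
  simp [agentInput, Matrix.mulVec, dotProduct]

/-- The vector of the `c`-th coordinates of outputs and controller states. -/
def coordMap (γ : ι → ℝ) (RK : Matrix ι κ ℝ) (c : Fin n) : State ι κ n →ₗ[ℝ] (ι ⊕ κ → ℝ) where
  toFun p := Sum.elim (fun i => outputMap γ RK p i c) (fun k => p.2 k c)
  map_add' p q := by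
    ext (i | k) <;> simp
  map_smul' a p := by
    ext (i | k) <;> simp

theorem coordMap_apply (γ : ι → ℝ) (RK : Matrix ι κ ℝ) (c : Fin n) (p : State ι κ n) :
    coordMap γ RK c p = Sum.elim (fun i => outputMap γ RK p i c) (fun k => p.2 k c) := rfl

variable [Fintype ι]

/-! ### Equilibria -/

theorem closedLoop_fst (α : ι → ℝ) (β : κ → ℝ) (γ : ι → ℝ) (f : ι → Vec n → ℝ)
    (RN RK : Matrix ι κ ℝ) (p : State ι κ n) (i : ι) :
    (closedLoop α β γ f RN RK p).1 i =
      α i • (agentInput RK p i - gradient (f i) (closedLoopOutput γ RK p i)) :=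
  agentDynamics_eq_smul _ _ _ _ _

theorem closedLoop_snd (α : ι → ℝ) (β : κ → ℝ) (γ : ι → ℝ) (f : ι → Vec n → ℝ)
    (RN RK : Matrix ι κ ℝ) (p : State ι κ n) (k : κ) :
    (closedLoop α β γ f RN RK p).2 k = β k • ∑ i, RN i k • closedLoopOutput γ RK p i := rfl

theorem mem_equilibria_closedLoop_iff {α : ι → ℝ} {β : κ → ℝ} {γ : ι → ℝ} {f : ι → Vec n → ℝ}
    {RN RK : Matrix ι κ ℝ} (hα : ∀ i, 0 < α i) (hβ : ∀ k, 0 < β k) {p : State ι κ n} :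
    p ∈ equilibria (closedLoop α β γ f RN RK) ↔
      (∀ i, gradient (f i) (closedLoopOutput γ RK p i) = agentInput RK p i) ∧
        ∀ k, ∑ i, RN i k • closedLoopOutput γ RK p i = 0 := by
  rw [equilibria, mem_ofPred_eq, Prod.ext_iff, funext_iff, funext_iff]
  refine and_congr (forall_congr' fun i => ?_) (forall_congr' fun k => ?_)
  · rw [closedLoop_fst]
    exact (smul_eq_zero_iff_right (hα i).ne').trans (sub_eq_zero.trans eq_comm)
  · rw [closedLoop_snd]
    exact smul_eq_zero_iff_right (hβ k).ne'

theorem HasNullspaceProperty.sum_agentInput {RK : Matrix ι κ ℝ} (hRK : HasNullspaceProperty RK)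
    (p : State ι κ n) : ∑ i, agentInput RK p i = 0 := by
  ext c
  have h := hRK.sum_mulVec fun k => p.2 k c
  simp only [WithLp.ofLp_sum, Finset.sum_apply, agentInput_coord, Finset.sum_neg_distrib, h]
  simp

/-- This is consensus at rest: controllers with zero input force equal outputs, one coordinate at a
time. -/
theorem HasNullspaceProperty.eq_of_sum_smul_eq_zero {ι κ : Type*} [Fintype ι] {n : ℕ}
    {R : Matrix ι κ ℝ}
    (hR : HasNullspaceProperty R) {y : ι → Vec n} (h : ∀ k, ∑ i, R i k • y i = 0) (i j : ι) :
    y i = y j := by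
  ext c
  obtain ⟨a, ha⟩ := (hR.mem_iff fun i => y i c).1 (by
    ext k
    rw [← sum_smul_coord, h k]
    rfl)
  rw [ha i, ha j]

variable {α : ι → ℝ} {β : κ → ℝ} {γ m : ι → ℝ} {f : ι → Vec n → ℝ} {RN RK : Matrix ι κ ℝ}

/-- The outputs of every equilibrium are the minimizer of the total objective. -/
theorem closedLoopOutput_eq_of_mem_equilibria
    (hα : ∀ i, 0 < α i) (hβ : ∀ k, 0 < β k) (hm : 0 < ∑ i, m i)
    (hf : ∀ i, StrongConvexOn univ (m i) (f i)) (hd : ∀ i, Differentiable ℝ (f i))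
    (hRN : HasNullspaceProperty RN) (hRK : HasNullspaceProperty RK)
    {ystar : Vec n} (hy : ∑ i, gradient (f i) ystar = 0) {p : State ι κ n}
    (hp : p ∈ equilibria (closedLoop α β γ f RN RK)) (i : ι) :
    closedLoopOutput γ RK p i = ystar := by
  obtain ⟨h1, h2⟩ := (mem_equilibria_closedLoop_iff hα hβ).1 hp
  by_contra hne
  have hsum : ∑ j, gradient (f j) (closedLoopOutput γ RK p i) = 0 := by
    rw [← hRK.sum_agentInput p]
    refine Finset.sum_congr rfl fun j _ => ?_
    rw [← h1 j, hRN.eq_of_sum_smul_eq_zero h2 i j]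
  -- Two distinct zeros of the total gradient would each have a strictly smaller total objective
  -- than the other.
  exact lt_asymm (sum_lt_sum_of_sum_gradient_eq_zero hm hf hd hy hne)
    (sum_lt_sum_of_sum_gradient_eq_zero hm hf hd hsum (Ne.symm hne))

/-- The inputs must equal the gradients at `ystar`. These sum to zero, hence lie in the range of
`R_K` coordinate by coordinate; the states are then read off from `y = x + γu`. -/
theorem nonempty_equilibria_closedLoop (hα : ∀ i, 0 < α i) (hβ : ∀ k, 0 < β k)
    (hRN : HasNullspaceProperty RN) (hRK : HasNullspaceProperty RK)
    {ystar : Vec n} (hy : ∑ i, gradient (f i) ystar = 0) :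
    (equilibria (closedLoop α β γ f RN RK)).Nonempty := by
  have hex : ∀ c : Fin n, ∃ z : κ → ℝ, RK *ᵥ z = fun i => -(gradient (f i) ystar c) := by
    intro c
    refine hRK.exists_mulVec_eq ?_
    have := congrArg (fun v : Vec n => v c) hy
    simp only [WithLp.ofLp_sum, Finset.sum_apply] at this
    rw [Finset.sum_neg_distrib, this]
    simp
  choose z hz using hex
  set p : State ι κ n := (fun i => ystar - γ i • gradient (f i) ystar,
    fun k => WithLp.toLp 2 fun c => z c k) with hp
  have hin : ∀ i, agentInput RK p i = gradient (f i) ystar := by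
    intro i
    ext c
    rw [agentInput_coord]
    have := congrFun (hz c) i
    simp only [hp]
    rw [this, neg_neg]
  have hout : ∀ i, closedLoopOutput γ RK p i = ystar := by
    intro i
    rw [closedLoopOutput, hin, agentOutput, hp]
    simp
  refine ⟨p, (mem_equilibria_closedLoop_iff hα hβ).2 ⟨fun i => by rw [hout, hin], fun k => ?_⟩⟩
  simp only [hout]
  ext c
  rw [sum_smul_coord, (hRN.mem_iff _).2 ⟨ystar c, fun _ => rfl⟩]
  rfl

/-! ### The Lyapunov function -/

/-- The sum of the storage functions of agents and controllers. -/
def lyapunov (α : ι → ℝ) (β : κ → ℝ) (q : State ι κ n) : ℝ :=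
  ∑ i, 1 / (2 * α i) * ‖q.1 i‖ ^ 2 + ∑ k, 1 / (2 * β k) * ‖q.2 k‖ ^ 2

/-- The derivative of the Lyapunov function at `q` in direction `w`. -/
def lyapunovRate (α : ι → ℝ) (β : κ → ℝ) (q w : State ι κ n) : ℝ :=
  ∑ i, 1 / α i * inner ℝ (q.1 i) (w.1 i) + ∑ k, 1 / β k * inner ℝ (q.2 k) (w.2 k)

theorem hasDerivAt_lyapunov {q : ℝ → State ι κ n} {w : State ι κ n} {t : ℝ}
    (h : HasDerivAt q w t) :
    HasDerivAt (fun t => lyapunov α β (q t)) (lyapunovRate α β (q t) w) t := by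
  have h1 : ∀ i, HasDerivAt (fun t => (q t).1 i) (w.1 i) t := fun i =>
    hasDerivAt_pi.1 ((hasFDerivAt_fst (𝕜 := ℝ)).comp_hasDerivAt t h) i
  have h2 : ∀ k, HasDerivAt (fun t => (q t).2 k) (w.2 k) t := fun k =>
    hasDerivAt_pi.1 ((hasFDerivAt_snd (𝕜 := ℝ)).comp_hasDerivAt t h) k
  have e : ∀ a b : ℝ, 1 / a * b = 1 / (2 * a) * (2 * b) := fun a b => by
    rw [one_div, one_div, mul_inv]
    ring
  simp only [lyapunov, lyapunovRate, e (α _), e (β _)]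
  exact (HasDerivAt.fun_sum fun i _ => (h1 i).norm_sq.const_mul _).fun_add
    (HasDerivAt.fun_sum fun k _ => (h2 k).norm_sq.const_mul _)

theorem lyapunov_nonneg (hα : ∀ i, 0 < α i) (hβ : ∀ k, 0 < β k) (q : State ι κ n) :
    0 ≤ lyapunov α β q :=
  add_nonneg
    (Finset.sum_nonneg fun i _ => by have := hα i; positivity)
    (Finset.sum_nonneg fun k _ => by have := hβ k; positivity)

/-- With `exists_norm_sq_le_lyapunov` this compares `V` with the squared sup norm of the state. The
added `1` keeps the constants positive for empty index types. -/
theorem exists_lyapunov_le (hα : ∀ i, 0 < α i) (hβ : ∀ k, 0 < β k) :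
    ∃ C, 0 < C ∧ ∀ q : State ι κ n, lyapunov α β q ≤ C * ‖q‖ ^ 2 := by
  refine ⟨∑ i, 1 / (2 * α i) + ∑ k, 1 / (2 * β k) + 1, ?_, fun q => ?_⟩
  · have h1 : 0 ≤ ∑ i, 1 / (2 * α i) := Finset.sum_nonneg fun i _ => by
      have := hα i; positivity
    have h2 : 0 ≤ ∑ k, 1 / (2 * β k) := Finset.sum_nonneg fun k _ => by
      have := hβ k; positivity
    linarith
  · rw [add_mul, add_mul, Finset.sum_mul, Finset.sum_mul, lyapunov]
    have h1 : ∑ i, 1 / (2 * α i) * ‖q.1 i‖ ^ 2 ≤ ∑ i, 1 / (2 * α i) * ‖q‖ ^ 2 :=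
      Finset.sum_le_sum fun i _ => by
        have := hα i
        have := (norm_le_pi_norm q.1 i).trans (norm_fst_le q)
        gcongr
    have h2 : ∑ k, 1 / (2 * β k) * ‖q.2 k‖ ^ 2 ≤ ∑ k, 1 / (2 * β k) * ‖q‖ ^ 2 :=
      Finset.sum_le_sum fun k _ => by
        have := hβ k
        have := (norm_le_pi_norm q.2 k).trans (norm_snd_le q)
        gcongr
    nlinarith [sq_nonneg ‖q‖]

theorem exists_norm_sq_le_lyapunov (hα : ∀ i, 0 < α i) (hβ : ∀ k, 0 < β k) :
    ∃ C, 0 < C ∧ ∀ q : State ι κ n, ‖q‖ ^ 2 ≤ C * lyapunov α β q := by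
  have hsα : 0 ≤ ∑ i, 2 * α i := Finset.sum_nonneg fun i _ => by have := hα i; positivity
  have hsβ : 0 ≤ ∑ k, 2 * β k := Finset.sum_nonneg fun k _ => by have := hβ k; positivity
  refine ⟨∑ i, 2 * α i + ∑ k, 2 * β k + 1, by linarith, fun q => ?_⟩
  set V := lyapunov α β q with hV
  have hV0 : 0 ≤ V := lyapunov_nonneg hα hβ q
  have hA0 : 0 ≤ ∑ i, 1 / (2 * α i) * ‖q.1 i‖ ^ 2 := Finset.sum_nonneg fun i _ => by
    have := hα i; positivity
  have hB0 : 0 ≤ ∑ k, 1 / (2 * β k) * ‖q.2 k‖ ^ 2 := Finset.sum_nonneg fun k _ => by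
    have := hβ k; positivity
  have hi : ∀ i, ‖q.1 i‖ ^ 2 ≤ 2 * α i * V := fun i => by
    have h1 : 1 / (2 * α i) * ‖q.1 i‖ ^ 2 ≤ V :=
      (Finset.single_le_sum (f := fun i => 1 / (2 * α i) * ‖q.1 i‖ ^ 2)
        (fun i _ => by have := hα i; positivity) (Finset.mem_univ i)).trans
        (le_add_of_nonneg_right hB0)
    have := hα i
    rwa [one_div_mul_eq_div, div_le_iff₀' (by positivity)] at h1
  have hk : ∀ k, ‖q.2 k‖ ^ 2 ≤ 2 * β k * V := fun k => by
    have h1 : 1 / (2 * β k) * ‖q.2 k‖ ^ 2 ≤ V :=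
      (Finset.single_le_sum (f := fun k => 1 / (2 * β k) * ‖q.2 k‖ ^ 2)
        (fun k _ => by have := hβ k; positivity) (Finset.mem_univ k)).trans
        (le_add_of_nonneg_left hA0)
    have := hβ k
    rwa [one_div_mul_eq_div, div_le_iff₀' (by positivity)] at h1
  have hle : ∀ r : ℝ, r ≤ ∑ i, 2 * α i + ∑ k, 2 * β k + 1 →
      r * V ≤ (∑ i, 2 * α i + ∑ k, 2 * β k + 1) * V := fun r hr =>
    mul_le_mul_of_nonneg_right hr hV0
  have hq : ‖q‖ ≤ √((∑ i, 2 * α i + ∑ k, 2 * β k + 1) * V) := by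
    refine norm_prod_le_iff.2 ⟨?_, ?_⟩
    · refine (pi_norm_le_iff_of_nonneg (Real.sqrt_nonneg _)).2 fun i => Real.le_sqrt_of_sq_le ?_
      refine (hi i).trans (hle _ ?_)
      have := Finset.single_le_sum (f := fun i => 2 * α i)
        (fun i _ => by have := hα i; positivity) (Finset.mem_univ i)
      linarith
    · refine (pi_norm_le_iff_of_nonneg (Real.sqrt_nonneg _)).2 fun k => Real.le_sqrt_of_sq_le ?_
      refine (hk k).trans (hle _ ?_)
      have := Finset.single_le_sum (f := fun k => 2 * β k)
        (fun k _ => by have := hβ k; positivity) (Finset.mem_univ k)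
      linarith
  have h3 := pow_le_pow_left₀ (norm_nonneg _) hq 2
  rwa [Real.sq_sqrt (mul_nonneg (by linarith) hV0)] at h3

/-- The dissipation inequality of the closed loop. -/
theorem lyapunovRate_le [DecidableEq ι] {ν ρ : ι → ℝ}
    (hα : ∀ i, 0 < α i) (hβ : ∀ k, 0 < β k)
    (hpass : ∀ i, AgentIsISOSEIP (α i) (γ i) (f i) (ν i) (ρ i))
    {pbar : State ι κ n} (hbar : pbar ∈ equilibria (closedLoop α β γ f RN RK)) (p : State ι κ n) :
    lyapunovRate α β (p - pbar) (closedLoop α β γ f RN RK p) ≤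
      -(1 / 2 * ∑ c, coordMap γ RK c (p - pbar) ⬝ᵥ
        stabilityMatrix ν ρ RN RK *ᵥ coordMap γ RK c (p - pbar)) := by
  have hbar' : ∀ i, agentDynamics (α i) (γ i) (f i) (pbar.1 i) (agentInput RK pbar i) = 0 :=
    fun i => congrFun (congrArg Prod.fst (show closedLoop α β γ f RN RK pbar = 0 from hbar)) i
  have hY : ∀ i, closedLoopOutput γ RK p i - closedLoopOutput γ RK pbar i
      = outputMap γ RK (p - pbar) i := fun i => by rw [map_sub]; rfl
  have hU : ∀ i, agentInput RK p i - agentInput RK pbar i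
      = agentInput RK (p - pbar) i := fun i =>
    (congrFun ((inputMap RK).map_sub p pbar) i).symm
  set q := p - pbar with hq
  have h1 : ∑ i, 1 / α i * inner ℝ (q.1 i) ((closedLoop α β γ f RN RK p).1 i) ≤
      ∑ i, passivitySupply (ν i) (ρ i) (agentInput RK q i) (outputMap γ RK q i) := by
    refine Finset.sum_le_sum fun i _ => ?_
    rw [← hU, ← hY]
    exact (hpass i).inner_le (hbar' i) (p.1 i) (agentInput RK p i)
  have h2 : ∑ k, 1 / β k * inner ℝ (q.2 k) ((closedLoop α β γ f RN RK p).2 k) =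
      ∑ k, inner ℝ (q.2 k) (∑ i, RN i k • outputMap γ RK q i) := by
    refine Finset.sum_congr rfl fun k _ => ?_
    -- The controller input vanishes at the equilibrium, so outputs may be replaced by output
    -- errors.
    have h3 := ((mem_equilibria_closedLoop_iff hα hβ).1 hbar).2 k
    rw [closedLoop_snd, real_inner_smul_right, ← mul_assoc, one_div_mul_cancel (hβ k).ne',
      one_mul, ← sub_zero (∑ i, RN i k • closedLoopOutput γ RK p i), ← h3,
      ← Finset.sum_sub_distrib]
    simp only [← smul_sub, hY]
  -- The agents supply `ỹᵀũ = -ỹᵀR_K z̃` and the controllers `z̃ᵀR_Nᵀỹ`; only the mismatch `R_K -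
  -- R_N` remains off the diagonal.
  have h4 : ∑ i, passivitySupply (ν i) (ρ i) (agentInput RK q i) (outputMap γ RK q i) +
      ∑ k, inner ℝ (q.2 k) (∑ i, RN i k • outputMap γ RK q i) =
      -(1 / 2 * ∑ c, coordMap γ RK c q ⬝ᵥ stabilityMatrix ν ρ RN RK *ᵥ coordMap γ RK c q) := by
    simp only [passivitySupply, inner_eq_sum_mul, coordMap_apply, dotProduct_stabilityMatrix,
      sum_smul_coord, agentInput_coord]
    rw [Finset.sum_comm (s := (Finset.univ : Finset κ))]
    simp only [Finset.mul_sum, ← Finset.sum_sub_distrib]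
    rw [Finset.sum_comm (s := (Finset.univ : Finset ι)), ← Finset.sum_add_distrib,
      ← Finset.sum_neg_distrib]
    refine Finset.sum_congr rfl fun c _ => ?_
    rw [← mul_assoc, one_div_mul_cancel two_ne_zero, one_mul, neg_sub, sub_eq_add_neg,
      ← Finset.sum_neg_distrib, add_comm]
    refine congrArg₂ _ rfl (Finset.sum_congr rfl fun i _ => ?_)
    ring
  rw [lyapunovRate, h2]
  linarith

end ClosedLoop

/-! ### Convergence of solutions. -/

noncomputable section Convergence

open Filter Set
open scoped NNReal

variable {ι κ : Type*} [Fintype ι] [Fintype κ] {n : ℕ}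
  {α : ι → ℝ} {β : κ → ℝ} {γ m : ι → ℝ} {f : ι → Vec n → ℝ} {RN RK : Matrix ι κ ℝ}

theorem _root_.LinearMap.exists_lipschitzWith {E F : Type*} [NormedAddCommGroup E]
    [NormedSpace ℝ E] [FiniteDimensional ℝ E] [NormedAddCommGroup F] [NormedSpace ℝ F]
    (T : E →ₗ[ℝ] F) : ∃ K : ℝ≥0, LipschitzWith K T :=
  ⟨_, T.toContinuousLinearMap.lipschitz⟩

theorem _root_.LinearMap.hasDerivAt_comp {E F : Type*} [NormedAddCommGroup E]
    [NormedSpace ℝ E] [FiniteDimensional ℝ E] [NormedAddCommGroup F] [NormedSpace ℝ F]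
    (T : E →ₗ[ℝ] F) {u : ℝ → E} {u' : E} {t : ℝ} (h : HasDerivAt u u' t) :
    HasDerivAt (fun t => T (u t)) (T u') t :=
  T.toContinuousLinearMap.hasFDerivAt.comp_hasDerivAt t h

theorem exists_lipschitzWith_pi {E : Type*} [PseudoMetricSpace E] {F : ι → Type*}
    [∀ i, PseudoMetricSpace (F i)] {g : E → ∀ i, F i}
    (h : ∀ i, ∃ K : ℝ≥0, LipschitzWith K fun x => g x i) : ∃ K : ℝ≥0, LipschitzWith K g := by
  choose K hK using h
  refine ⟨∑ i, K i, LipschitzWith.of_dist_le_mul fun x y => ?_⟩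
  refine (dist_pi_le_iff (by positivity)).2 fun i => ((hK i).dist_le_mul x y).trans ?_
  refine mul_le_mul_of_nonneg_right ?_ dist_nonneg
  exact_mod_cast Finset.single_le_sum (fun i _ => zero_le) (Finset.mem_univ i)

theorem exists_lipschitzWith_closedLoop {l : ι → ℝ≥0}
    (hl : ∀ i, LipschitzWith (l i) (gradient (f i))) :
    ∃ K : ℝ≥0, LipschitzWith K (closedLoop α β γ f RN RK) := by
  obtain ⟨Ku, hKu⟩ := (inputMap (n := n) RK).exists_lipschitzWith
  obtain ⟨Ky, hKy⟩ := (outputMap (n := n) γ RK).exists_lipschitzWith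
  have hu : ∀ i, LipschitzWith (1 * Ku) fun p : State ι κ n => agentInput RK p i := fun i =>
    (LipschitzWith.eval i).comp hKu
  have hy : ∀ i, LipschitzWith (1 * Ky) fun p : State ι κ n => closedLoopOutput γ RK p i :=
    fun i => (LipschitzWith.eval i).comp hKy
  obtain ⟨K₁, h₁⟩ : ∃ K : ℝ≥0, LipschitzWith K fun p => (closedLoop α β γ f RN RK p).1 := by
    refine exists_lipschitzWith_pi fun i => ?_
    simp only [closedLoop_fst]
    exact ⟨_, (lipschitzWith_smul (α i)).comp ((hu i).sub ((hl i).comp (hy i)))⟩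
  obtain ⟨K₂, h₂⟩ : ∃ K : ℝ≥0, LipschitzWith K fun p => (closedLoop α β γ f RN RK p).2 := by
    let T : (ι → Vec n) →ₗ[ℝ] (κ → Vec n) :=
      LinearMap.pi fun k => β k • ∑ i, RN i k • LinearMap.proj i
    obtain ⟨K, hK⟩ := T.exists_lipschitzWith
    refine ⟨K * Ky, ?_⟩
    have e : (fun p => (closedLoop α β γ f RN RK p).2) = T ∘ outputMap γ RK := by
      ext1 p
      ext1 k
      simp [T, closedLoop_snd, outputMap_apply]
    rw [e]
    exact hK.comp hKy
  exact ⟨_, h₁.prodMk h₂⟩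

theorem IsSolution.hasDerivAt {X : Type*} [NormedAddCommGroup X] [NormedSpace ℝ X] {F : X → X}
    {φ : ℝ → X} (h : IsSolution F φ) {t : ℝ} (ht : 0 < t) : HasDerivAt φ (F (φ t)) t :=
  (h t ht.le).hasDerivAt (Ici_mem_nhds ht)

theorem IsSolution.continuousOn {X : Type*} [NormedAddCommGroup X] [NormedSpace ℝ X] {F : X → X}
    {φ : ℝ → X} (h : IsSolution F φ) : ContinuousOn φ (Ici 0) :=
  fun t ht => (h t ht).continuousWithinAt

theorem continuous_lyapunov : Continuous (lyapunov (n := n) α β) := by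
  unfold lyapunov
  fun_prop

/-- Along every solution the vector field vanishes asymptotically, once the outputs converge. -/
theorem IsSolution.tendsto_closedLoop (hα : ∀ i, 0 < α i) (hβ : ∀ k, 0 < β k)
    {l : ι → ℝ≥0} (hl : ∀ i, LipschitzWith (l i) (gradient (f i)))
    {p : State ι κ n} (hp : p ∈ equilibria (closedLoop α β γ f RN RK))
    {φ : ℝ → State ι κ n} (hφ : IsSolution (closedLoop α β γ f RN RK) φ) {C : ℝ}
    (hC : ∀ t, 0 ≤ t → ‖φ t - p‖ ≤ C)
    (hy : Tendsto (fun t => closedLoopOutput γ RK (φ t)) atTop (𝓝 (closedLoopOutput γ RK p))) :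
    Tendsto (fun t => closedLoop α β γ f RN RK (φ t)) atTop (𝓝 0) := by
  obtain ⟨hp1, hp2⟩ := (mem_equilibria_closedLoop_iff hα hβ).1 hp
  have hyi := tendsto_pi_nhds.1 hy
  have h2 : Tendsto (fun t => (closedLoop α β γ f RN RK (φ t)).2) atTop (𝓝 0) := by
    rw [tendsto_pi_nhds]
    intro k
    have h : Tendsto (fun t => β k • ∑ i, RN i k • closedLoopOutput γ RK (φ t) i) atTop
        (𝓝 (β k • ∑ i, RN i k • closedLoopOutput γ RK p i)) :=
      (tendsto_finsetSum _ fun i _ => (hyi i).const_smul _).const_smul _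
    rwa [hp2, smul_zero] at h
  -- By linearity this is the time derivative of the input; it involves only `z'`.
  have hU : ∀ i, Tendsto (fun t => agentInput RK (closedLoop α β γ f RN RK (φ t)) i) atTop
      (𝓝 0) := by
    intro i
    have h : Tendsto (fun t => -∑ k, RK i k • (closedLoop α β γ f RN RK (φ t)).2 k) atTop
        (𝓝 (-∑ k, RK i k • (0 : Vec n))) :=
      (tendsto_finsetSum _ fun k _ => (tendsto_pi_nhds.1 h2 k).const_smul _).neg
    simp only [smul_zero, Finset.sum_const_zero, neg_zero] at h
    exact h
  have h1 : Tendsto (fun t => (closedLoop α β γ f RN RK (φ t)).1) atTop (𝓝 0) := by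
    rw [tendsto_pi_nhds]
    intro i
    let g := gradient (f i) (closedLoopOutput γ RK p i)
    let S : State ι κ n →ₗ[ℝ] Vec n :=
      { toFun := fun q => q.1 i, map_add' := fun _ _ => rfl, map_smul' := fun _ _ => rfl }
    -- The gradients converge to `g`, so `x_i' ≈ -α_i (g - u_i)` with `u_i` slowly varying.
    -- Boundedness of `x_i` then forces `u_i → g`.
    have hlim : Tendsto (fun t => (closedLoop α β γ f RN RK (φ t)).1 i +
        α i • (g - agentInput RK (φ t) i)) atTop (𝓝 0) := by
      have h := (((hl i).continuous.tendsto _).comp (hyi i)).const_sub g |>.const_smul (α i)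
      rw [sub_self, smul_zero] at h
      refine h.congr fun t => ?_
      rw [closedLoop_fst, ← smul_add, Function.comp]
      congr 1
      abel
    have ha := tendsto_zero_of_bounded_of_slowly_varying (v := fun t => (φ t - p).1 i)
      (v' := fun t => (closedLoop α β γ f RN RK (φ t)).1 i)
      (a := fun t => α i • (g - agentInput RK (φ t) i))
      (a' := fun t => α i • -agentInput RK (closedLoop α β γ f RN RK (φ t)) i) (C := C)
      (fun t ht => S.hasDerivAt_comp ((hφ.hasDerivAt ht).sub_const p))
      (fun t ht => by
        have h := hasDerivAt_pi.1 ((inputMap RK).hasDerivAt_comp (hφ.hasDerivAt ht)) i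
        exact (h.const_sub g).const_smul (α i))
      (fun t ht => ((norm_le_pi_norm _ i).trans (norm_fst_le _)).trans (hC t ht))
      hlim (by simpa using (hU i).neg.const_smul (α i))
    simpa using hlim.sub ha
  exact h1.prodMk_nhds h2

variable [DecidableEq ι] {ν ρ : ι → ℝ}

theorem dotProduct_mulVec_coordMap_nonneg (hM : (stabilityMatrix ν ρ RN RK).PosSemidef)
    (q : State ι κ n) (c : Fin n) :
    0 ≤ coordMap γ RK c q ⬝ᵥ stabilityMatrix ν ρ RN RK *ᵥ coordMap γ RK c q := by
  simpa using hM.dotProduct_mulVec_nonneg (coordMap γ RK c q)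

theorem IsSolution.antitoneOn_lyapunov (hα : ∀ i, 0 < α i) (hβ : ∀ k, 0 < β k)
    (hpass : ∀ i, AgentIsISOSEIP (α i) (γ i) (f i) (ν i) (ρ i))
    (hM : (stabilityMatrix ν ρ RN RK).PosSemidef)
    {p : State ι κ n} (hp : p ∈ equilibria (closedLoop α β γ f RN RK))
    {φ : ℝ → State ι κ n} (hφ : IsSolution (closedLoop α β γ f RN RK) φ) :
    AntitoneOn (fun t => lyapunov α β (φ t - p)) (Ici 0) := by
  refine antitoneOn_of_hasDerivWithinAt_nonpos (convex_Ici _)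
    (continuous_lyapunov.comp_continuousOn (hφ.continuousOn.sub continuousOn_const))
    (fun t ht => (hasDerivAt_lyapunov ((hφ.hasDerivAt ?_).sub_const p)).hasDerivWithinAt)
    (fun t _ => (lyapunovRate_le hα hβ hpass hp (φ t)).trans ?_)
  · rwa [interior_Ici] at ht
  · have := Finset.sum_nonneg fun c (_ : c ∈ Finset.univ) =>
      dotProduct_mulVec_coordMap_nonneg (γ := γ) hM (φ t - p) c
    linarith

/-- Solutions do not move away from equilibria by more than a fixed factor. -/
theorem exists_dist_solution_le (hα : ∀ i, 0 < α i) (hβ : ∀ k, 0 < β k)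
    (hpass : ∀ i, AgentIsISOSEIP (α i) (γ i) (f i) (ν i) (ρ i))
    (hM : (stabilityMatrix ν ρ RN RK).PosSemidef) :
    ∃ C, 0 < C ∧ ∀ p ∈ equilibria (closedLoop α β γ f RN RK), ∀ φ,
      IsSolution (closedLoop α β γ f RN RK) φ → ∀ s t, 0 ≤ s → s ≤ t →
        dist (φ t) p ≤ C * dist (φ s) p := by
  obtain ⟨A, hA, hlA⟩ := exists_lyapunov_le (n := n) hα hβ
  obtain ⟨B, hB, hlB⟩ := exists_norm_sq_le_lyapunov (n := n) hα hβ
  refine ⟨√(B * A), by positivity, fun p hp φ hφ s t hs hst => ?_⟩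
  rw [dist_eq_norm, dist_eq_norm]
  refine le_of_sq_le_sq ?_ (by positivity)
  rw [mul_pow, Real.sq_sqrt (by positivity), mul_assoc]
  refine (hlB _).trans (mul_le_mul_of_nonneg_left ?_ hB.le)
  exact (hφ.antitoneOn_lyapunov hα hβ hpass hM hp hs (hs.trans hst) hst).trans (hlA _)

/-- The output errors and the controller states balance asymptotically. -/
theorem IsSolution.tendsto_stabilityMatrix_mulVec (hα : ∀ i, 0 < α i) (hβ : ∀ k, 0 < β k)
    (hpass : ∀ i, AgentIsISOSEIP (α i) (γ i) (f i) (ν i) (ρ i))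
    (hM : (stabilityMatrix ν ρ RN RK).PosSemidef)
    {p : State ι κ n} (hp : p ∈ equilibria (closedLoop α β γ f RN RK))
    {φ : ℝ → State ι κ n} (hφ : IsSolution (closedLoop α β γ f RN RK) φ) {D : ℝ}
    (hD : ∀ t, 0 ≤ t → ‖closedLoop α β γ f RN RK (φ t)‖ ≤ D) (c : Fin n) :
    Tendsto (fun t => stabilityMatrix ν ρ RN RK *ᵥ coordMap γ RK c (φ t - p)) atTop (𝓝 0) := by
  classical
  obtain ⟨B, hB⟩ := hM.exists_eq_transpose_mul_self
  have hform : ∀ v, v ⬝ᵥ stabilityMatrix ν ρ RN RK *ᵥ v = ∑ j, (B *ᵥ v) j ^ 2 := by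
    intro v
    rw [hB, ← Matrix.mulVec_mulVec, Matrix.dotProduct_mulVec, Matrix.vecMul_transpose]
    exact Finset.sum_congr rfl fun j _ => (sq _).symm
  have hD0 : 0 ≤ D := (norm_nonneg _).trans (hD 0 le_rfl)
  -- Each component is Lipschitz in time because the velocity is bounded by `D`, and its square is
  -- dominated by the dissipation, so `tendsto_zero_of_dissipation` applies.
  have hBv : Tendsto (fun t => B *ᵥ coordMap γ RK c (φ t - p)) atTop (𝓝 0) := by
    rw [tendsto_pi_nhds]
    intro j
    obtain ⟨K, hK⟩ := (B.mulVecLin ∘ₗ coordMap (n := n) γ RK c).exists_lipschitzWith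
    refine tendsto_zero_of_dissipation (V := fun t => lyapunov α β (φ t - p)) (c := 1 / 2)
      (K := K * D) (by norm_num) (by positivity)
      (fun t ht => hasDerivAt_lyapunov ((hφ.hasDerivAt ht).sub_const p))
      (fun t => lyapunov_nonneg hα hβ _)
      (fun t ht => (lyapunovRate_le hα hβ hpass hp (φ t)).trans ?_) (fun s t hs hst => ?_)
    · refine neg_le_neg (mul_le_mul_of_nonneg_left ?_ (by norm_num))
      refine le_trans ?_ (Finset.single_le_sum
        (fun c _ => dotProduct_mulVec_coordMap_nonneg (γ := γ) hM (φ t - p) c)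
        (Finset.mem_univ c))
      rw [hform]
      exact Finset.single_le_sum
        (f := fun j => (B *ᵥ coordMap γ RK c (φ t - p)) j ^ 2)
        (fun j _ => sq_nonneg _) (Finset.mem_univ j)
    · have h1 := norm_image_sub_le_of_norm_deriv_le_segment' (f := φ) (a := s) (b := t) (C := D)
        (fun r hr => (hφ r (hs.trans hr.1)).mono (Icc_subset_Ici_self.trans (Ici_subset_Ici.2 hs)))
        (fun r hr => hD r (hs.trans hr.1)) t ⟨hst, le_rfl⟩
      have h2 := hK.dist_le_mul (φ t - p) (φ s - p)
      rw [dist_sub_right, dist_eq_norm (φ t)] at h2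
      have h3 := (dist_le_pi_dist _ _ j).trans h2
      rw [Real.dist_eq] at h3
      refine h3.trans ?_
      rw [mul_assoc]
      exact mul_le_mul_of_nonneg_left h1 K.2
  have h := ((continuous_mulVec Bᵀ).tendsto 0).comp hBv
  rw [Matrix.mulVec_zero] at h
  refine h.congr fun t => ?_
  rw [Function.comp, Matrix.mulVec_mulVec, ← hB]

theorem stabilityMatrix_mulVec_sumElim_inl (y : ι → ℝ) (z : κ → ℝ) (i : ι) :
    (stabilityMatrix ν ρ RN RK *ᵥ Sum.elim y z) (Sum.inl i) =
      ((2 : ℝ) • matK ρ *ᵥ y + (RK - RN) *ᵥ z) i := by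
  rw [stabilityMatrix, Matrix.fromBlocks_mulVec, Sum.elim_inl, Matrix.smul_mulVec]
  rfl

/-- The outputs of every solution converge to those of an equilibrium. -/
theorem IsSolution.tendsto_outputMap_sub [DecidableEq κ] (hα : ∀ i, 0 < α i) (hβ : ∀ k, 0 < β k)
    (hρ : ∀ i, 0 < ρ i) (hpass : ∀ i, AgentIsISOSEIP (α i) (γ i) (f i) (ν i) (ρ i))
    (hM : (stabilityMatrix ν ρ RN RK).PosSemidef)
    (hRN : HasNullspaceProperty RN) (hRK : HasNullspaceProperty RK)
    (heig : EigenvaluesZeroOrPosRe (slowMatrix β ρ RN RK))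
    {p : State ι κ n} (hp : p ∈ equilibria (closedLoop α β γ f RN RK))
    {φ : ℝ → State ι κ n} (hφ : IsSolution (closedLoop α β γ f RN RK) φ) {C D : ℝ}
    (hC : ∀ t, 0 ≤ t → ‖φ t - p‖ ≤ C)
    (hD : ∀ t, 0 ≤ t → ‖closedLoop α β γ f RN RK (φ t)‖ ≤ D) :
    Tendsto (fun t => outputMap γ RK (φ t - p)) atTop (𝓝 0) := by
  have hcoord : ∀ c, Tendsto (fun t i => outputMap γ RK (φ t - p) i c) atTop (𝓝 0) := by
    intro c
    have hC0 : 0 ≤ C := (norm_nonneg _).trans (hC 0 le_rfl)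
    refine tendsto_zero_of_slow_dynamics (z := fun t k => (φ t - p).2 k c) (C := C)
      hβ hρ hRN hRK heig (fun t ht => ?_) (fun t ht => ?_) ?_
    · rw [hasDerivAt_pi]
      intro k
      let T : State ι κ n →ₗ[ℝ] ℝ :=
        { toFun := fun q => q.2 k c, map_add' := fun _ _ => rfl, map_smul' := fun _ _ => rfl }
      have h := T.hasDerivAt_comp ((hφ.hasDerivAt ht).sub_const p)
      have e : (Matrix.diagonal β *ᵥ RNᵀ *ᵥ fun i => outputMap γ RK (φ t - p) i c) k =
          T (closedLoop α β γ f RN RK (φ t)) := by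
        have h0 := ((mem_equilibria_closedLoop_iff hα hβ).1 hp).2 k
        have e1 : ∑ i, RN i k • outputMap γ RK (φ t - p) i =
            ∑ i, RN i k • closedLoopOutput γ RK (φ t) i := by
          rw [← sub_zero (∑ i, RN i k • closedLoopOutput γ RK (φ t) i), ← h0,
            ← Finset.sum_sub_distrib]
          simp only [← smul_sub, map_sub, Pi.sub_apply]
          rfl
        rw [Matrix.mulVec_diagonal, ← sum_smul_coord, e1]
        rfl
      rw [e]
      exact h
    · refine (pi_norm_le_iff_of_nonneg hC0).2 fun k => ?_
      exact ((PiLp.norm_apply_le _ c).trans ((norm_le_pi_norm _ k).trans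
        (norm_snd_le _))).trans (hC t ht)
    · have h := hφ.tendsto_stabilityMatrix_mulVec hα hβ hpass hM hp hD c
      rw [tendsto_pi_nhds] at h ⊢
      intro i
      refine (h (Sum.inl i)).congr fun t => ?_
      rw [coordMap_apply, stabilityMatrix_mulVec_sumElim_inl]
  rw [tendsto_pi_nhds]
  intro i
  have h : Tendsto (fun t c => outputMap γ RK (φ t - p) i c) atTop (𝓝 0) :=
    tendsto_pi_nhds.2 fun c => tendsto_pi_nhds.1 (hcoord c) i
  exact ((PiLp.continuous_toLp 2 _).tendsto 0).comp h

/-- A bounded solution along which the vector field vanishes converges to an equilibrium, if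
solutions stay close to equilibria. -/
theorem IsSolution.exists_tendsto_equilibrium {X : Type*} [NormedAddCommGroup X] [NormedSpace ℝ X]
    [ProperSpace X] {F : X → X} (hF : Continuous F) {C : ℝ} (hC : 0 < C)
    {φ : ℝ → X} (hφ : ∀ p ∈ equilibria F, ∀ s t, 0 ≤ s → s ≤ t →
      dist (φ t) p ≤ C * dist (φ s) p) (hne : (equilibria F).Nonempty)
    (hlim : Tendsto (fun t => F (φ t)) atTop (𝓝 0)) :
    ∃ p ∈ equilibria F, Tendsto φ atTop (𝓝 p) := by
  obtain ⟨p₀, hp₀⟩ := hne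
  obtain ⟨p, -, σ, hσ, hp⟩ := (isCompact_closedBall p₀ (C * dist (φ 0) p₀)).tendsto_subseq
    (x := fun j : ℕ => φ j) fun j => hφ p₀ hp₀ 0 j le_rfl j.cast_nonneg
  have hσ' : Tendsto (fun j => ((σ j : ℕ) : ℝ)) atTop atTop :=
    tendsto_natCast_atTop_atTop.comp hσ.tendsto_atTop
  have hpe : p ∈ equilibria F :=
    tendsto_nhds_unique ((hF.tendsto p).comp hp) (hlim.comp hσ')
  -- The distance estimate holds relative to the limit point `p` itself: once the solution is within
  -- `ε / C` of `p`, it stays within `ε`.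
  refine ⟨p, hpe, Metric.tendsto_atTop.2 fun ε hε => ?_⟩
  obtain ⟨j, hj⟩ := (Metric.tendsto_atTop.1 hp (ε / C) (by positivity))
  refine ⟨(σ j : ℝ), fun t ht => (hφ p hpe _ t (Nat.cast_nonneg _) ht).trans_lt ?_⟩
  have := hj j le_rfl
  rwa [lt_div_iff₀' hC] at this

end Convergence

end DistOpt

/-! ### Assembly of the main theorem. -/

theorem mainTheorem6 {N M n : ℕ} (hN : 0 < N)
    (α γ m : Fin N → ℝ) (l : Fin N → NNReal) (β : Fin M → ℝ) (f : Fin N → DistOpt.Vec n → ℝ)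
    (RN RK : Matrix (Fin N) (Fin M) ℝ)
    (hα : ∀ i, 0 < α i) (hβ : ∀ k, 0 < β k) (hγ : ∀ i, 0 ≤ γ i) (hm : ∀ i, 0 < m i)
    (hdiff : ∀ i, Differentiable ℝ (f i))
    (hconv : ∀ i, StrongConvexOn Set.univ (m i) (f i))
    (hlip : ∀ i, LipschitzWith (l i) (gradient (f i)))
    (hRN : DistOpt.HasNullspaceProperty RN) (hRK : DistOpt.HasNullspaceProperty RK) :
    (∀ i, DistOpt.AgentIsISOSEIP (α i) (γ i) (f i)
      (1 / 2 * γ i) (m i - 1 / 2 * γ i * (l i : ℝ) ^ 2)) ∧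
    ∀ ν ρ : Fin N → ℝ, (∀ i, 0 < ρ i) →
      (∀ i, DistOpt.AgentIsISOSEIP (α i) (γ i) (f i) (ν i) (ρ i)) →
      (DistOpt.stabilityMatrix ν ρ RN RK).PosSemidef →
      DistOpt.EigenvaluesZeroOrPosRe (DistOpt.slowMatrix β ρ RN RK) →
      ∃ ystar : DistOpt.Vec n,
        (∀ y, y ≠ ystar → ∑ i, f i ystar < ∑ i, f i y) ∧
        (∀ p ∈ DistOpt.equilibria (DistOpt.closedLoop α β γ f RN RK),
          ∀ i, DistOpt.closedLoopOutput γ RK p i = ystar) ∧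
        DistOpt.IsGloballyAsymptoticallyStable (DistOpt.closedLoop α β γ f RN RK)
          (DistOpt.equilibria (DistOpt.closedLoop α β γ f RN RK)) ∧
        (∀ φ, DistOpt.IsSolution (DistOpt.closedLoop α β γ f RN RK) φ →
          ∀ i, Filter.Tendsto (fun t => DistOpt.closedLoopOutput γ RK (φ t) i)
            Filter.atTop (𝓝 ystar)) := by
  refine ⟨fun i => DistOpt.agentIsISOSEIP_of_strongConvexOn (hα i) (hγ i) (hdiff i) (hconv i)
    (hlip i), fun ν ρ hρ hpass hM heig => ?_⟩
  have hmsum : 0 < ∑ i, m i := Finset.sum_pos (fun i _ => hm i) ⟨⟨0, hN⟩, Finset.mem_univ _⟩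
  obtain ⟨ystar, hy⟩ := DistOpt.exists_sum_gradient_eq_zero hmsum hconv hdiff
  have hout : ∀ p ∈ DistOpt.equilibria (DistOpt.closedLoop α β γ f RN RK),
      ∀ i, DistOpt.closedLoopOutput γ RK p i = ystar := fun p hp =>
    DistOpt.closedLoopOutput_eq_of_mem_equilibria hα hβ hmsum hconv hdiff hRN hRK hy hp
  obtain ⟨p, hp⟩ := DistOpt.nonempty_equilibria_closedLoop (γ := γ) hα hβ hRN hRK hy
  obtain ⟨C, hC, hdist⟩ := DistOpt.exists_dist_solution_le hα hβ hpass hM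
  obtain ⟨K, hK⟩ := DistOpt.exists_lipschitzWith_closedLoop (α := α) (β := β) (γ := γ)
    (RN := RN) (RK := RK) hlip
  have hbdd : ∀ φ, DistOpt.IsSolution (DistOpt.closedLoop α β γ f RN RK) φ →
      ∀ t, 0 ≤ t → ‖φ t - p‖ ≤ C * ‖φ 0 - p‖ := fun φ hφ t ht => by
    simpa only [dist_eq_norm] using hdist p hp φ hφ 0 t le_rfl ht
  have hlim : ∀ φ, DistOpt.IsSolution (DistOpt.closedLoop α β γ f RN RK) φ →
      Filter.Tendsto (fun t => DistOpt.closedLoopOutput γ RK (φ t)) Filter.atTop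
        (𝓝 (DistOpt.closedLoopOutput γ RK p)) := by
    intro φ hφ
    have h := hφ.tendsto_outputMap_sub hα hβ hρ hpass hM hRN hRK heig hp (hbdd φ hφ)
      -- The vector field vanishes at `p`, so its Lipschitz constant turns the bound on the distance
      -- to `p` into a bound on the velocity.
      (D := K * (C * ‖φ 0 - p‖)) fun t ht => by
        have h1 := hK.dist_le_mul (φ t) p
        rw [show DistOpt.closedLoop α β γ f RN RK p = 0 from hp, dist_zero_right,
          dist_eq_norm] at h1
        exact h1.trans (mul_le_mul_of_nonneg_left (hbdd φ hφ t ht) K.2)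
    have h2 := h.add_const (DistOpt.outputMap γ RK p)
    simp only [map_sub, sub_add_cancel, zero_add] at h2
    exact h2
  refine ⟨ystar, fun y hne =>
    DistOpt.sum_lt_sum_of_sum_gradient_eq_zero hmsum hconv hdiff hy hne, hout,
    ⟨fun p₀ => DistOpt.exists_isSolution_of_lipschitz hK p₀, fun ε hε => ?_, fun φ hφ => ?_⟩,
    fun φ hφ i => ?_⟩
  · refine ⟨ε / C, by positivity, fun q hq φ hφ h0 t ht => ?_⟩
    refine (hdist q hq φ hφ 0 t le_rfl ht).trans_lt ?_
    rwa [lt_div_iff₀' hC] at h0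
  · exact DistOpt.IsSolution.exists_tendsto_equilibrium hK.continuous hC
      (fun q hq => hdist q hq φ hφ) ⟨p, hp⟩
      (hφ.tendsto_closedLoop hα hβ hlip hp (hbdd φ hφ) (hlim φ hφ))
  · rw [← hout p hp i]
    exact tendsto_pi_nhds.1 (hlim φ hφ) i
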